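/- Let $m\ge 3$ be an integer, and let $G=\mathrm{CC}_{m,3}$ be the cycle-chord graph with vertices $v_1,\dots,v_{m+2}$ whose edges are those of the cycle $v_1v_2\dotsm v_{m+2}v_1$ together with the chord $v_2v_{m+1}$ (that is, an $m$-cycle and a $4$-cycle glued along the edge $v_2v_{m+1}$). Then $G$ is $(e)$-positive. Here the following definitions are used. For a graph $G$ with labelled vertices $v_1,\dots,v_d$, \[ Y_G=\sum_{\kappa}x_{\kappa(v_1)}x_{\kappa(v_2)}\dotsm x_{\kappa(v_d)} \] is its chromatic symmetric function in the noncommuting variables $x_1,x_2,\dots$, where $\kappa$ runs over all proper colorings of $G$ by positive integers. For a partition $\pi$ of the set $[d]=\{1,\dots,d\}$, the elementary symmetric function in noncommuting variables is $e_\pi=\sum_{(i_1,\dots,i_d)}x_{i_1}\dotsm x_{i_d}$, where the sum runs over all sequences of positive integers such that $i_j\ne i_k$ whenever $j\ne k$ lie in the same block of $\pi$. The $e_\pi$ are linearly independent, and $Y_G=\sum_{\sigma}c_\sigma e_\sigma$ for unique rational numbers $c_\sigma$, where $\sigma$ runs over the partitions of $[d]$. Two partitions $\pi,\sigma$ of $[d]$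 are congruent if they have the same multiset of block sizes and the block containing $d$ has the same size in both. The graph $G$ is called $(e)$-positive if $\sum_{\sigma\in C}c_\sigma\ge 0$ for every congruence class $C$ of partitions of $[d]$. -/

import Mathlib

namespace NCChromatic

/-- Formal power series with rational coefficients in the noncommuting variables
`x_1, x_2, …`: a coefficient for every word in the positive integers. -/
abbrev NCSeries : Type := FreeMonoid ℕ+ → ℚ

/-- The word `x_{s(1)} x_{s(2)} ⋯ x_{s(d)}` of a sequence `s` of `d` positive integers. -/
def word {d : ℕ} (s : Fin d → ℕ+) : FreeMonoid ℕ+ :=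
  FreeMonoid.ofList (List.ofFn s)

/-- The formal sum `∑_{s ∈ S} x_{s(1)} ⋯ x_{s(d)}` over a set `S` of sequences: the coefficient
of a word `w` is the number of `s ∈ S` whose word is `w` (at most one such `s` exists). -/
noncomputable def sumOfMonomials {d : ℕ} (S : Set (Fin d → ℕ+)) : NCSeries :=
  fun w => ({s ∈ S | word s = w}.ncard : ℚ)

/-- The chromatic symmetric function `Y_G` in noncommuting variables of a graph `G` with vertices
`v_1, …, v_d` (the vertex `v_j` is the element `j - 1` of `Fin d`): the sum of
`x_{κ(v_1)} ⋯ x_{κ(v_d)}` over all proper colorings `κ` of `G` by positive integers. -/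
noncomputable def Y {d : ℕ} (G : SimpleGraph (Fin d)) : NCSeries :=
  sumOfMonomials {κ | ∀ u v, G.Adj u v → κ u ≠ κ v}

/-- The partitions of the set `[d]`. -/
abbrev SetPartition (d : ℕ) : Type := Finpartition (Finset.univ : Finset (Fin d))

/-- The elementary symmetric function `e_π` in noncommuting variables: the sum of
`x_{i_1} ⋯ x_{i_d}` over the sequences with `i_j ≠ i_k` for distinct `j`, `k` in the same block
of `π`. -/
noncomputable def elementary {d : ℕ} (π : SetPartition d) : NCSeries :=
  sumOfMonomials {s | ∀ B ∈ π.parts, ∀ j ∈ B, ∀ k ∈ B, j ≠ k → s j ≠ s k}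

/-- The type `λ(π)`: the multiset of block sizes. -/
def blockType {d : ℕ} (π : SetPartition d) : Multiset ℕ :=
  π.parts.val.map Finset.card

/-- `b_{π,i}`: the size of the block of `π` that contains `i`. -/
def blockSize {d : ℕ} (π : SetPartition d) (i : Fin d) : ℕ :=
  (π.part i).card

/-- Congruence of set partitions modulo `i`. -/
def CongrMod {d : ℕ} (i : Fin d) (π σ : SetPartition d) : Prop :=
  blockType π = blockType σ ∧ blockSize π i = blockSize σ i

instance {d : ℕ} (i : Fin d) (π σ : SetPartition d) : Decidable (CongrMod i π σ) :=
  inferInstanceAs (Decidable (_ ∧ _))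

/-- The class coefficient `c_{(π)_i}`: the sum of `c_σ` over all `σ` congruent to `π` modulo `i`. -/
def classCoeff {d : ℕ} (i : Fin d) (c : SetPartition d → ℚ) (π : SetPartition d) : ℚ :=
  ∑ σ : SetPartition d with CongrMod i π σ, c σ

/-- `G` is `(e)`-positive modulo `i`: in the expansion `Y_G = ∑_σ c_σ e_σ` all class coefficients
`c_{(π)_i}` are nonnegative. (The `e_σ`, for the partitions `σ` of `[d]`, are linearly independent,
so there is only one such expansion.) -/
def IsEPositiveMod {d : ℕ} (G : SimpleGraph (Fin d)) (i : Fin d) : Prop :=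
  ∃ c : SetPartition d → ℚ,
    Y G = ∑ σ : SetPartition d, c σ • elementary σ ∧
    ∀ π : SetPartition d, 0 ≤ classCoeff i c π

/-- `G`, with vertices `v_1, …, v_{n+1}`, is `(e)`-positive: it is so modulo its last label. -/
def IsEPositive {n : ℕ} (G : SimpleGraph (Fin (n + 1))) : Prop :=
  IsEPositiveMod G (Fin.last n)

/-- The cycle `v_1 v_2 ⋯ v_{m+2} v_1` together with the chord `v_2 v_{m+1}`
(`v_j` is the element `j - 1` of `Fin (m + 2)`). -/
def cycleChordThree (m : ℕ) : SimpleGraph (Fin (m + 2)) :=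
  SimpleGraph.cycleGraph (m + 2) ⊔ SimpleGraph.edge ⟨1, by omega⟩ ⟨m, by omega⟩

end NCChromatic

/-! Let the variables commute, keep only d = m + 2 of them, and remember the colour i of the last
vertex. Then e_σ becomes a positive integer times the product of the e_{|B|} over the blocks B not
containing the last vertex, times M_{i,b} = x_i e_{b-1}(variables other than x_i), where b is the
size of the remaining block. This image depends only on the congruence class of σ, and the images of
distinct classes, taken as families indexed by i, are linearly independent. Hence the class
coefficients can be read off, up to positive factors, from the sum of the monomials of the proper
colourings whose last colour is i (`sum_proper_prod_X_eq`, `isEPositiveMod_of_sum_proper_eq`).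

That sum is computed by a generating function in m. Put E = ∏ (1 + x_c z), θ = z d/dz and f_c = x_c
z / (1 + x_c z). For the path v_2 … v_{m+1} with end colours b ≠ c, the generating function W
satisfies D W = E f_b f_c, where D = E - θE = 1 - ∑ (k - 1) e_k z^k. Attaching v_1 and v_{m+2} and
summing over the colours, D times the full series has the z^n coefficient (n² - 3n + 3) e_n M_{i,2}
+ (n² - 3n + 2) e_{n+1} M_{i,1} + (n - 2) e_1 M_{i,n+1} + (3n - 3) M_{i,n+2}
(`coeff_denomSeries_mul_markedSeries`). It vanishes for n = 0, 1 and has nonnegative coefficients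
for n ≥ 2. Since 1/D is a geometric series in ∑ (k - 1) e_k z^k, its coefficients are nonnegative in
the e_k too, and so are those of the product.

The existence of the expansion of Y_G in the e_σ is proved separately, by Möbius inversion on the
partition lattice. -/

namespace NCChromatic

open Finset

/-! ### Factorization over blocks -/

section Factorization

variable {d : ℕ} {C R : Type*} [Fintype C] [CommSemiring R]

/-- A sum over all sequences of a product of factors, one for each block of `σ`, is a product
of sums over the sequences on the blocks. -/
theorem sum_prod_parts (σ : SetPartition d) (g : (B : Finset (Fin d)) → (B → C) → R) :
    ∑ s : Fin d → C, ∏ B ∈ σ.parts, g B (fun j => s j) =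
      ∏ B ∈ σ.parts, ∑ t : B → C, g B t := by
  classical
  rw [← Finset.prod_coe_sort σ.parts, Finset.prod_univ_sum, Fintype.piFinset_univ]
  refine Fintype.sum_bijective
    (fun (s : Fin d → C) (B : σ.parts) (j : (B : Finset (Fin d))) => s j) ⟨?_, ?_⟩ _ _ ?_
  · intro s s' h
    funext j
    have h1 := congrFun h ⟨σ.part j, σ.part_mem.2 (mem_univ j)⟩
    exact congrFun h1 ⟨j, σ.mem_part_self.2 (mem_univ j)⟩
  · intro F
    refine ⟨fun j => F ⟨σ.part j, σ.part_mem.2 (mem_univ j)⟩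
      ⟨j, σ.mem_part_self.2 (mem_univ j)⟩, ?_⟩
    funext ⟨B, hB⟩ ⟨j, hj⟩
    obtain rfl : σ.part j = B := σ.part_eq_of_mem hB hj
    rfl
  · intro s
    rw [← Finset.prod_coe_sort σ.parts]

end Factorization

/-! ### Kernel partitions and the partition lattice -/

section Lattice

variable {d : ℕ} {C : Type*}

/-- The sequence `s` takes distinct values on each block of `σ`. -/
def InjOnParts (σ : SetPartition d) (s : Fin d → C) : Prop :=
  ∀ B ∈ σ.parts, ∀ j ∈ B, ∀ k ∈ B, j ≠ k → s j ≠ s k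

/-- The partition into the level sets of a sequence. -/
noncomputable def kerPartition (s : Fin d → C) : SetPartition d :=
  haveI : DecidableRel (Setoid.ker s).r := Classical.decRel _
  Finpartition.ofSetoid (Setoid.ker s)

theorem mem_part_kerPartition {s : Fin d → C} {a b : Fin d} :
    b ∈ (kerPartition s).part a ↔ s a = s b := by
  classical
  rw [kerPartition, Finpartition.mem_part_ofSetoid_iff_rel]
  rfl

theorem setPartition_le_iff {ρ σ : SetPartition d} :
    ρ ≤ σ ↔ ∀ a b, b ∈ ρ.part a → b ∈ σ.part a := by
  constructor
  · intro h a b hb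
    obtain ⟨c, hc, hle⟩ := h (ρ.part_mem.2 (mem_univ a))
    rw [σ.part_eq_of_mem hc (hle (ρ.mem_part_self.2 (mem_univ a)))]
    exact hle hb
  · intro h B hB
    obtain ⟨a, ha⟩ := ρ.nonempty_of_mem_parts hB
    refine ⟨σ.part a, σ.part_mem.2 (mem_univ a), fun b hb => h a b ?_⟩
    rwa [ρ.part_eq_of_mem hB ha]

theorem mem_part_inf {ρ σ : SetPartition d} {a b : Fin d} :
    b ∈ (ρ ⊓ σ).part a ↔ b ∈ ρ.part a ∧ b ∈ σ.part a := by
  constructor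
  · intro h
    exact ⟨setPartition_le_iff.1 inf_le_left a b h, setPartition_le_iff.1 inf_le_right a b h⟩
  · rintro ⟨h1, h2⟩
    have hmem : ρ.part a ⊓ σ.part a ∈ (ρ ⊓ σ).parts := by
      rw [Finpartition.parts_inf]
      refine mem_erase.2 ⟨?_, mem_image.2 ⟨(ρ.part a, σ.part a), ?_, rfl⟩⟩
      · exact Finset.ne_empty_of_mem (mem_inter.2 ⟨h1, h2⟩)
      · exact mem_product.2 ⟨ρ.part_mem.2 (mem_univ a), σ.part_mem.2 (mem_univ a)⟩
    rw [(ρ ⊓ σ).part_eq_of_mem hmem (mem_inter.2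
      ⟨ρ.mem_part_self.2 (mem_univ a), σ.mem_part_self.2 (mem_univ a)⟩)]
    exact mem_inter.2 ⟨h1, h2⟩

theorem mem_part_bot {a b : Fin d} : b ∈ (⊥ : SetPartition d).part a ↔ a = b := by
  rw [Finpartition.mem_part_iff_exists]
  simp only [Finpartition.mem_bot_iff]
  constructor
  · rintro ⟨p, ⟨c, -, rfl⟩, hb, ha⟩
    rw [mem_singleton] at hb ha
    rw [ha, hb]
  · rintro rfl
    exact ⟨{a}, ⟨a, mem_univ a, rfl⟩, mem_singleton_self a, mem_singleton_self a⟩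

theorem injOnParts_iff_mem_part {σ : SetPartition d} {s : Fin d → C} :
    InjOnParts σ s ↔ ∀ a b, b ∈ σ.part a → s a = s b → a = b := by
  constructor
  · intro h a b hb hs
    by_contra hne
    exact h _ (σ.part_mem.2 (mem_univ a)) a (σ.mem_part_self.2 (mem_univ a)) b hb hne hs
  · intro h B hB j hj k hk hne hs
    refine hne (h j k ?_ hs)
    rwa [σ.part_eq_of_mem hB hj]

/-- Only the kernel of `s` matters, which turns the expansion in the e_σ into a question about
functions on the partition lattice. -/
theorem injOnParts_iff_inf_eq_bot {σ : SetPartition d} {s : Fin d → C} :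
    InjOnParts σ s ↔ σ ⊓ kerPartition s = ⊥ := by
  rw [injOnParts_iff_mem_part, ← le_bot_iff, setPartition_le_iff]
  simp only [mem_part_inf, mem_part_kerPartition, mem_part_bot, and_imp]

theorem le_kerPartition_iff {σ : SetPartition d} {s : Fin d → C} :
    σ ≤ kerPartition s ↔ ∀ B ∈ σ.parts, ∀ j ∈ B, ∀ k ∈ B, s j = s k := by
  rw [setPartition_le_iff]
  simp only [mem_part_kerPartition]
  constructor
  · intro h B hB j hj k hk
    exact h j k (by rwa [σ.part_eq_of_mem hB hj])
  · intro h a b hb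
    exact h _ (σ.part_mem.2 (mem_univ a)) a (σ.mem_part_self.2 (mem_univ a)) b hb

end Lattice

/-! ### Möbius inversion and existence of expansions -/

section Moebius

/-- The Möbius numbers `μ(⊥, x)` of a finite partial order. -/
theorem exists_moebius_bot (α : Type*) [Fintype α] [PartialOrder α] [OrderBot α]
    [DecidableEq α] [DecidableLE α] [DecidableLT α] :
    ∃ μ : α → ℤ, ∀ x, ∑ y with y ≤ x, μ y = if x = ⊥ then 1 else 0 := by
  let _ : LocallyFiniteOrder α := Fintype.toLocallyFiniteOrder
  refine ⟨fun y => IncidenceAlgebra.mu ℤ ⊥ y, fun x => ?_⟩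
  have h := IncidenceAlgebra.sum_Icc_mu_right (𝕜 := ℤ) (⊥ : α) x
  rw [show (Finset.univ.filter (fun y => y ≤ x)) = Icc ⊥ x by ext; simp, h]
  simp only [eq_comm]

variable {d : ℕ}

open Classical in
theorem card_injOnParts (σ : SetPartition d) (N : ℕ) :
    #{s : Fin d → Fin N | InjOnParts σ s} = ∏ B ∈ σ.parts, N.descFactorial #B := by
  have h := sum_prod_parts (C := Fin N) (R := ℕ) σ
    (fun B t => if Function.Injective t then 1 else 0)
  rw [card_filter]
  trans ∑ s : Fin d → Fin N, ∏ B ∈ σ.parts,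
      if Function.Injective (fun j : B => s j) then 1 else 0
  · refine sum_congr rfl fun s _ => ?_
    rw [prod_ite_zero]
    simp only [prod_const_one]
    refine if_congr ?_ rfl rfl
    refine forall₂_congr fun B hB => ?_
    constructor
    · intro h j k hjk
      by_contra hne
      exact h j j.2 k k.2 (fun h => hne (Subtype.ext h)) hjk
    · intro h j hj k hk hne hs
      exact hne (congrArg Subtype.val (@h ⟨j, hj⟩ ⟨k, hk⟩ hs))
  · rw [h]
    refine prod_congr rfl fun B _ => ?_
    rw [← card_filter, ← Fintype.card_subtype,
      Fintype.card_congr (Equiv.subtypeInjectiveEquivEmbedding B (Fin N)),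
      Fintype.card_embedding_eq]
    simp

open Classical in
theorem card_le_kerPartition (σ : SetPartition d) (N : ℕ) :
    #{s : Fin d → Fin N | σ ≤ kerPartition s} = N ^ #σ.parts := by
  have h := sum_prod_parts (C := Fin N) (R := ℕ) σ
    (fun B t => if ∀ j k : B, t j = t k then 1 else 0)
  rw [card_filter]
  trans ∑ s : Fin d → Fin N, ∏ B ∈ σ.parts,
      if ∀ j k : B, s j = s k then 1 else 0
  · refine sum_congr rfl fun s _ => ?_
    rw [prod_ite_zero]
    simp only [prod_const_one, le_kerPartition_iff, Subtype.forall]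
  · rw [h, ← prod_const]
    refine prod_congr rfl fun B hB => ?_
    obtain ⟨b, hb⟩ := σ.nonempty_of_mem_parts hB
    rw [← card_filter]
    trans #(univ : Finset (Fin N))
    · refine card_bij' (fun t _ => t ⟨b, hb⟩) (fun c _ => fun _ => c) ?_ ?_ ?_ ?_
      · simp
      · simp
      · intro t ht
        funext j
        exact (mem_filter.1 ht).2 _ _
      · simp
    · simp

/-- Sending a block of `ρ` to the block of `σ` around it is surjective; with equally many blocks it
would be injective, forcing `σ ≤ ρ`. -/
theorem card_parts_lt_of_lt {ρ σ : SetPartition d} (h : ρ < σ) : #σ.parts < #ρ.parts := by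
  refine lt_of_le_of_ne (Finpartition.card_mono h.le) fun hcard => h.not_ge ?_
  have hle := setPartition_le_iff.1 h.le
  have hg : ∀ a, (ρ.part a).biUnion σ.part = σ.part a := by
    intro a
    ext b
    rw [mem_biUnion]
    constructor
    · rintro ⟨c, hc, hb⟩
      rwa [← σ.part_eq_of_mem (σ.part_mem.2 (mem_univ a)) (hle a c hc)]
    · intro hb
      exact ⟨a, ρ.mem_part_self.2 (mem_univ a), hb⟩
  have himage : ρ.parts.image (fun B => B.biUnion σ.part) = σ.parts := by
    ext B
    rw [mem_image]
    constructor
    · rintro ⟨A, hA, rfl⟩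
      obtain ⟨a, ha⟩ := ρ.nonempty_of_mem_parts hA
      rw [← ρ.part_eq_of_mem hA ha, hg]
      exact σ.part_mem.2 (mem_univ a)
    · intro hB
      obtain ⟨a, ha⟩ := σ.nonempty_of_mem_parts hB
      exact ⟨ρ.part a, ρ.part_mem.2 (mem_univ a), by rw [hg, σ.part_eq_of_mem hB ha]⟩
  have hinj := card_image_iff.1 (by rw [himage, hcard] :
    #(ρ.parts.image (fun B => B.biUnion σ.part)) = #ρ.parts)
  refine setPartition_le_iff.2 fun a b hb => ?_
  have hab : σ.part b = σ.part a := σ.part_eq_of_mem (σ.part_mem.2 (mem_univ a)) hb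
  have : ρ.part a = ρ.part b := by
    refine hinj (ρ.part_mem.2 (mem_univ a)) (ρ.part_mem.2 (mem_univ b)) ?_
    simp only [hg, hab]
  rw [this]
  exact ρ.mem_part_self.2 (mem_univ b)

-- Both sides count the sequences injective on the blocks of `τ`: the indicator of this property at
-- `s` is the sum of `μ ρ` over `ρ ≤ τ ⊓ kerPartition s`, and the sums over `s` and `ρ` are
-- exchanged.
open Classical in
theorem sum_moebius_mul_pow {μ : SetPartition d → ℤ}
    (hμ : ∀ x, ∑ y with y ≤ x, μ y = if x = ⊥ then 1 else 0) (τ : SetPartition d) (N : ℕ) :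
    ∑ ρ with ρ ≤ τ, μ ρ * (N : ℤ) ^ #ρ.parts = ∏ B ∈ τ.parts, (N.descFactorial #B : ℤ) := by
  rw [← Nat.cast_prod, ← card_injOnParts, card_filter, Nat.cast_sum]
  trans ∑ s : Fin d → Fin N, ∑ ρ with ρ ≤ τ, if ρ ≤ kerPartition s then μ ρ else 0
  · rw [sum_comm]
    refine sum_congr rfl fun ρ _ => ?_
    rw [← Nat.cast_pow, ← card_le_kerPartition, card_filter, Nat.cast_sum, mul_sum]
    refine sum_congr rfl fun s _ => ?_
    split_ifs <;> simp
  · refine sum_congr rfl fun s _ => ?_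
    rw [← sum_filter, filter_filter]
    simp only [← le_inf_iff]
    rw [hμ, injOnParts_iff_inf_eq_bot]
    split_ifs <;> simp

-- Take a prime N > d in the counting identity. If `μ τ` were 0, only partitions with more blocks
-- than `τ` would contribute, so N would divide the count at least `#τ.parts + 1` times. But each
-- falling factorial contains N exactly once, its other factors lying strictly between 0 and N.
open Classical in
theorem moebius_ne_zero {μ : SetPartition d → ℤ}
    (hμ : ∀ x, ∑ y with y ≤ x, μ y = if x = ⊥ then 1 else 0) (τ : SetPartition d) :
    μ τ ≠ 0 := by
  intro h0
  obtain ⟨N, hdN, hN⟩ := Nat.exists_infinite_primes (d + 1)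
  have key := sum_moebius_mul_pow hμ τ N
  have hdvd : (N : ℤ) ^ (#τ.parts + 1) ∣ ∏ B ∈ τ.parts, (N.descFactorial #B : ℤ) := by
    rw [← key]
    refine dvd_sum fun ρ hρ => ?_
    rcases (mem_filter.1 hρ).2.eq_or_lt with rfl | hlt
    · rw [h0, zero_mul]
      exact dvd_zero _
    · exact (pow_dvd_pow _ (card_parts_lt_of_lt hlt)).mul_left _
  have hprod : ∏ B ∈ τ.parts, N.descFactorial #B =
      N ^ #τ.parts * ∏ B ∈ τ.parts, (N - 1).descFactorial (#B - 1) := by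
    rw [← prod_const, ← prod_mul_distrib]
    refine prod_congr rfl fun B hB => ?_
    have hpos : 0 < #B := card_pos.2 (τ.nonempty_of_mem_parts hB)
    obtain ⟨k, hk⟩ := Nat.exists_eq_succ_of_ne_zero hpos.ne'
    obtain ⟨n, rfl⟩ := Nat.exists_eq_succ_of_ne_zero hN.ne_zero
    rw [hk, Nat.succ_descFactorial_succ]
    rfl
  have hdvd' : N ^ (#τ.parts + 1) ∣ ∏ B ∈ τ.parts, N.descFactorial #B := by
    exact_mod_cast hdvd
  rw [hprod, pow_succ] at hdvd'
  have h2 := Nat.dvd_of_mul_dvd_mul_left (pow_pos hN.pos _) hdvd'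
  obtain ⟨B, hB, h3⟩ := (hN.prime.dvd_finsetProd_iff _).1 h2
  have hcard : #B ≤ d := by simpa using card_le_univ B
  rw [Nat.descFactorial_eq_prod_range] at h3
  obtain ⟨j, hj, h4⟩ := (hN.prime.dvd_finsetProd_iff _).1 h3
  have hj' := mem_range.1 hj
  exact absurd (Nat.le_of_dvd (by omega) h4) (by omega)

open Classical in
/-- Every function of the kernel partition is a combination of the indicators of being
injective on the blocks of a partition. -/
theorem exists_combination_injOnParts (g : SetPartition d → ℚ) :
    ∃ c : SetPartition d → ℚ, ∀ s : Fin d → ℕ+,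
      g (kerPartition s) = ∑ σ, c σ * if InjOnParts σ s then 1 else 0 := by
  obtain ⟨μ, hμ⟩ := exists_moebius_bot (SetPartition d)
  let e : SetPartition d → SetPartition d → ℚ := fun σ κ => if σ ⊓ κ = ⊥ then 1 else 0
  let p : SetPartition d → SetPartition d → ℚ := fun σ κ => if σ ≤ κ then 1 else 0
  have hep : ∀ τ, e τ = ∑ ρ with ρ ≤ τ, (μ ρ : ℚ) • p ρ := by
    intro τ
    funext κ
    have h := hμ (τ ⊓ κ)
    simp only [le_inf_iff] at h
    rw [← filter_filter, sum_filter] at h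
    rw [Finset.sum_apply]
    have h' := congrArg (Int.cast : ℤ → ℚ) h
    push_cast at h'
    simp only [e, p, Pi.smul_apply, smul_eq_mul, mul_ite, mul_one, mul_zero, ← h']
  -- The system `hep` is triangular with diagonal entries `μ τ ≠ 0`, so it is solved for `p` from
  -- the bottom of the lattice upwards.
  have hp : ∀ τ, p τ ∈ Submodule.span ℚ (Set.range e) := by
    intro τ
    induction τ using WellFoundedLT.induction with
    | ind τ ih =>
      have h1 : univ.filter (fun ρ => ρ ≤ τ) = insert τ (univ.filter (fun ρ => ρ < τ)) := by
        ext ρ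
        simp [le_iff_eq_or_lt]
      have h2 := hep τ
      rw [h1, sum_insert (by simp)] at h2
      have h3 : p τ = (μ τ : ℚ)⁻¹ • (e τ - ∑ ρ with ρ < τ, (μ ρ : ℚ) • p ρ) := by
        rw [h2, add_sub_cancel_right, smul_smul,
          inv_mul_cancel₀ (by exact_mod_cast moebius_ne_zero hμ τ), one_smul]
      rw [h3]
      refine Submodule.smul_mem _ _ (Submodule.sub_mem _ (Submodule.subset_span ⟨τ, rfl⟩)
        (Submodule.sum_mem _ fun ρ hρ => Submodule.smul_mem _ _ (ih ρ (mem_filter.1 hρ).2)))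
  -- Since `p τ` is the indicator of the elements above `τ`, point indicators are recovered from the
  -- top downwards.
  have hm : ∀ τ, (Pi.single τ 1 : SetPartition d → ℚ) ∈ Submodule.span ℚ (Set.range e) := by
    intro τ
    induction τ using WellFoundedGT.induction with
    | ind τ ih =>
      have h3 : (Pi.single τ 1 : SetPartition d → ℚ) =
          p τ - ∑ ρ with τ < ρ, (Pi.single ρ 1 : SetPartition d → ℚ) := by
        funext κ
        rw [Pi.sub_apply, Finset.sum_apply]
        simp only [Pi.single_apply, p, sum_ite_eq, mem_filter, mem_univ, true_and]
        rcases eq_or_ne κ τ with rfl | hne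
        · simp
        · simp [hne, lt_iff_le_and_ne, hne.symm]
      rw [h3]
      exact Submodule.sub_mem _ (hp τ)
        (Submodule.sum_mem _ fun ρ hρ => ih ρ (mem_filter.1 hρ).2)
  have hg : g ∈ Submodule.span ℚ (Set.range e) := by
    rw [pi_eq_sum_univ' g]
    exact Submodule.sum_mem _ fun τ _ => Submodule.smul_mem _ _ (by
      convert hm τ using 1)
  obtain ⟨c, hc⟩ := (Submodule.mem_span_range_iff_exists_fun ℚ).1 hg
  refine ⟨c, fun s => ?_⟩
  rw [← hc, Finset.sum_apply]
  refine sum_congr rfl fun σ _ => ?_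
  simp only [e, Pi.smul_apply, smul_eq_mul, injOnParts_iff_inf_eq_bot]

end Moebius

/-! ### Comparing coefficients of words -/

section Words

variable {d : ℕ}

theorem word_injective : Function.Injective (word (d := d)) := fun _ _ h =>
  List.ofFn_injective (FreeMonoid.ofList.injective h)

open Classical in
theorem sumOfMonomials_word (S : Set (Fin d → ℕ+)) (s : Fin d → ℕ+) :
    sumOfMonomials S (word s) = if s ∈ S then 1 else 0 := by
  unfold sumOfMonomials
  split_ifs with h
  · rw [show {t | t ∈ S ∧ word t = word s} = {s} from ?_, Set.ncard_singleton, Nat.cast_one]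
    ext t
    exact ⟨fun ht => word_injective ht.2, fun ht => by rw [Set.mem_singleton_iff.1 ht]; exact ⟨h, rfl⟩⟩
  · rw [show {t | t ∈ S ∧ word t = word s} = ∅ from ?_, Set.ncard_empty, Nat.cast_zero]
    ext t
    refine ⟨fun ht => h ?_, fun ht => ht.elim⟩
    rw [← word_injective ht.2]
    exact ht.1

theorem sumOfMonomials_of_notMem_range (S : Set (Fin d → ℕ+)) {w : FreeMonoid ℕ+}
    (hw : w ∉ Set.range (word (d := d))) : sumOfMonomials S w = 0 := by
  unfold sumOfMonomials
  rw [show {t | t ∈ S ∧ word t = w} = ∅ from ?_, Set.ncard_empty, Nat.cast_zero]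
  ext t
  exact ⟨fun ht => hw ⟨t, ht.2⟩, fun ht => ht.elim⟩

open Classical in
theorem Y_eq_sum_elementary_iff {G : SimpleGraph (Fin d)} {c : SetPartition d → ℚ} :
    Y G = ∑ σ, c σ • elementary σ ↔ ∀ s : Fin d → ℕ+,
      (if ∀ u v, G.Adj u v → s u ≠ s v then 1 else 0 : ℚ) =
        ∑ σ, c σ * if InjOnParts σ s then 1 else 0 := by
  constructor
  · intro h s
    have h1 := congrFun h (word s)
    rw [Finset.sum_apply, Y, sumOfMonomials_word] at h1
    simp only [Set.mem_ofPred_eq, Pi.smul_apply, elementary, sumOfMonomials_word,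
      smul_eq_mul] at h1
    convert h1
    exact Iff.rfl
  · intro h
    funext w
    rw [Finset.sum_apply]
    by_cases hw : w ∈ Set.range (word (d := d))
    · obtain ⟨s, rfl⟩ := hw
      simp only [Y, Pi.smul_apply, elementary, sumOfMonomials_word, smul_eq_mul]
      convert h s <;> exact Iff.rfl
    · simp only [Y, Pi.smul_apply, elementary, sumOfMonomials_of_notMem_range _ hw,
        smul_zero, sum_const_zero]

open Classical in
/-- The chromatic symmetric function in noncommuting variables is a combination of the `e_σ`. -/
theorem exists_Y_eq_sum_elementary (G : SimpleGraph (Fin d)) :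
    ∃ c : SetPartition d → ℚ, Y G = ∑ σ, c σ • elementary σ := by
  obtain ⟨c, hc⟩ := exists_combination_injOnParts (d := d)
    (fun κ => if ∀ u v, G.Adj u v → v ∉ κ.part u then 1 else 0)
  refine ⟨c, Y_eq_sum_elementary_iff.2 fun s => ?_⟩
  rw [← hc]
  simp only [mem_part_kerPartition, ne_eq]

end Words

/-! ### Sums over injective colourings of one block -/

section Esymm

variable {C : Type*} [DecidableEq C]

/-- The elementary symmetric polynomial of degree `k` in the variables with index in `A`. -/
noncomputable def esymmOn {C : Type*} (A : Finset C) (k : ℕ) : MvPolynomial C ℚ :=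
  ∑ t ∈ A.powersetCard k, ∏ c ∈ t, MvPolynomial.X c

theorem esymmOn_univ {C : Type*} [Fintype C] (k : ℕ) :
    esymmOn (univ : Finset C) k = MvPolynomial.esymm C ℚ k := rfl

/-- The sum of `x_{i} x_{s(2)} ⋯ x_{s(b)}` over the `(b - 1)`-subsets of the colours other
than `i`. -/
noncomputable def markedEsymm [Fintype C] (i : C) (b : ℕ) : MvPolynomial C ℚ :=
  MvPolynomial.X i * esymmOn (univ.erase i) (b - 1)

open Classical in
theorem card_injective_image_eq {ι : Type*} [Fintype ι] [DecidableEq ι] [Fintype C] {T : Finset C}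
    (hT : #T = Fintype.card ι) :
    #{t : ι → C | Function.Injective t ∧ univ.image t = T} = (Fintype.card ι).factorial := by
  rw [← Fintype.card_subtype]
  have e : {t : ι → C // Function.Injective t ∧ univ.image t = T} ≃ (ι ↪ T) :=
    { toFun := fun t => ⟨fun j => ⟨t.1 j, by
          have := mem_image_of_mem t.1 (mem_univ j)
          rwa [t.2.2] at this⟩, fun j k h => t.2.1 (congrArg Subtype.val h)⟩
      invFun := fun f => ⟨fun j => f j, fun j k h => f.injective (Subtype.ext h), by
          refine eq_of_subset_of_card_le ?_ ?_
          · intro c hc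
            obtain ⟨j, -, rfl⟩ := mem_image.1 hc
            exact (f j).2
          · rw [card_image_of_injective _ fun j k h => f.injective (Subtype.ext h), hT, card_univ]⟩
      left_inv := fun t => rfl
      right_inv := fun f => rfl }
  rw [Fintype.card_congr e, Fintype.card_embedding_eq, Fintype.card_coe, hT,
    Nat.descFactorial_self]

-- Group the injections by their image: each subset of the right size is the image of (card ι)! of
-- them.
open Classical in
theorem sum_injective_prod_X {ι : Type*} [Fintype ι] [DecidableEq ι] [Fintype C] (A : Finset C) :
    ∑ t : ι → C with Function.Injective t ∧ ∀ j, t j ∈ A, ∏ j, (MvPolynomial.X (t j) :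
      MvPolynomial C ℚ) = (Fintype.card ι).factorial * esymmOn A (Fintype.card ι) := by
  rw [← sum_fiberwise_of_maps_to (t := A.powersetCard (Fintype.card ι))
    (g := fun t : ι → C => univ.image t), esymmOn, mul_sum]
  · refine sum_congr rfl fun T hT => ?_
    rw [mem_powersetCard] at hT
    have h1 : filter (fun t : ι → C => univ.image t = T)
        (filter (fun t : ι → C => Function.Injective t ∧ ∀ j, t j ∈ A) univ) =
        filter (fun t : ι → C => Function.Injective t ∧ univ.image t = T) univ := by
      ext t
      simp only [mem_filter, mem_univ, true_and]
      refine ⟨fun h => ⟨h.1.1, h.2⟩, fun h => ⟨⟨h.1, fun j => hT.1 ?_⟩, h.2⟩⟩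
      rw [← h.2]
      exact mem_image_of_mem t (mem_univ j)
    rw [h1, ← card_injective_image_eq hT.2, ← nsmul_eq_mul, ← sum_const]
    refine sum_congr rfl fun t ht => ?_
    obtain ⟨h2, h3⟩ := (mem_filter.1 ht).2
    rw [← h3, prod_image fun a _ b _ h => h2 h]
  · intro t ht
    obtain ⟨h2, h3⟩ := (mem_filter.1 ht).2
    rw [mem_powersetCard]
    refine ⟨fun c hc => ?_, by rw [card_image_of_injective _ h2, card_univ]⟩
    obtain ⟨j, -, rfl⟩ := mem_image.1 hc
    exact h3 j

open Classical in
theorem sum_injective_prod_X_of_eq {ι : Type*} [Fintype ι] [DecidableEq ι] [Fintype C] (a : ι) (i : C) :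
    ∑ t : ι → C with Function.Injective t ∧ t a = i, ∏ j, (MvPolynomial.X (t j) :
      MvPolynomial C ℚ) =
      (Fintype.card ι - 1).factorial * markedEsymm i (Fintype.card ι) := by
  have h := sum_injective_prod_X (ι := {j // j ≠ a}) ((univ : Finset C).erase i)
  have hcard : Fintype.card {j // j ≠ a} = Fintype.card ι - 1 := by
    simp [Fintype.card_subtype_compl]
  rw [hcard] at h
  rw [markedEsymm, mul_left_comm, ← h, mul_sum]
  refine sum_bij' (fun t _ j => t j) (fun t _ j => if h : j = a then i else t ⟨j, h⟩)
    ?_ ?_ ?_ ?_ ?_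
  · intro t ht
    obtain ⟨h2, h3⟩ := (mem_filter.1 ht).2
    refine mem_filter.2 ⟨mem_univ _, fun j k h => Subtype.ext (h2 h), fun j => ?_⟩
    rw [mem_erase, ← h3]
    exact ⟨fun h => j.2 (h2 h), mem_univ _⟩
  · intro t ht
    obtain ⟨h2, h3⟩ := (mem_filter.1 ht).2
    refine mem_filter.2 ⟨mem_univ _, fun j k h => ?_, by simp⟩
    by_cases hj : j = a <;> by_cases hk : k = a
    · rw [hj, hk]
    · simp only [hj, hk, dite_true, dite_false] at h
      exact absurd h.symm (mem_erase.1 (h3 ⟨k, hk⟩)).1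
    · simp only [hj, hk, dite_true, dite_false] at h
      exact absurd h (mem_erase.1 (h3 ⟨j, hj⟩)).1
    · simp only [hj, hk, dite_false] at h
      exact congrArg Subtype.val (h2 h)
  · intro t ht
    funext j
    by_cases hj : j = a
    · simp only [hj, dite_true]
      exact (mem_filter.1 ht).2.2.symm
    · simp only [hj, dite_false]
  · intro t ht
    funext j
    simp only [j.2, dite_false]
  · intro t ht
    rw [← (mem_filter.1 ht).2.2]
    exact Fintype.prod_eq_mul_prod_subtype_ne _ a

end Esymm

/-! ### Commutative image with one marked colour -/

section Image

variable {d : ℕ} {C : Type*} [Fintype C] [DecidableEq C]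

open Classical in
/-- The image of `e_σ` when all variables commute but the colour of the vertex `a` is
remembered. -/
theorem sum_injOnParts_prod_X (σ : SetPartition d) (a : Fin d) (i : C) :
    ∑ s : Fin d → C with InjOnParts σ s ∧ s a = i, ∏ j, (MvPolynomial.X (s j) :
      MvPolynomial C ℚ) =
      (∏ B ∈ σ.parts.erase (σ.part a), ((#B).factorial * MvPolynomial.esymm C ℚ #B)) *
        (((blockSize σ a - 1).factorial : MvPolynomial C ℚ) * markedEsymm i (blockSize σ a)) := by
  -- The colour condition is vacuous on blocks without `a`, so the constraint `s a = i` splits over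
  -- the blocks along with injectivity.
  have h := sum_prod_parts (C := C) (R := MvPolynomial C ℚ) σ
    (fun B t => if Function.Injective t ∧ ∀ h : a ∈ B, t ⟨a, h⟩ = i then
      ∏ j, MvPolynomial.X (t j) else 0)
  rw [← mul_prod_erase _ _ (σ.part_mem.2 (mem_univ a)), mul_comm] at h
  rw [sum_filter]
  convert h using 2
  · rename_i s _
    rw [prod_ite_zero]
    have h1 : (∏ j, MvPolynomial.X (s j) : MvPolynomial C ℚ) =
        ∏ B ∈ σ.parts, ∏ j : B, MvPolynomial.X (s j) := by
      trans ∏ j ∈ σ.parts.biUnion id, MvPolynomial.X (s j)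
      · rw [σ.biUnion_parts]
      rw [prod_biUnion σ.disjoint]
      exact prod_congr rfl fun B _ => (prod_coe_sort B fun j => (MvPolynomial.X (s j) :
        MvPolynomial C ℚ)).symm
    rw [h1]
    have h4 : InjOnParts σ s ∧ s a = i ↔ ∀ B ∈ σ.parts, (Function.Injective fun j : B => s j) ∧
        (a ∈ B → s a = i) := ?_
    · simp only [h4]
    constructor
    · rintro ⟨h2, h3⟩ B hB
      refine ⟨fun j k hjk => ?_, fun _ => h3⟩
      by_contra hne
      exact h2 B hB j j.2 k k.2 (fun h => hne (Subtype.ext h)) hjk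
    · intro h2
      refine ⟨fun B hB j hj k hk hne hs =>
        hne (congrArg Subtype.val (@(h2 B hB).1 ⟨j, hj⟩ ⟨k, hk⟩ hs)), ?_⟩
      exact (h2 _ (σ.part_mem.2 (mem_univ a))).2 (σ.mem_part_self.2 (mem_univ a))
  · refine prod_congr rfl fun B hB => ?_
    have ha : a ∉ B := fun ha =>
      (mem_erase.1 hB).1 (σ.part_eq_of_mem (mem_erase.1 hB).2 ha).symm
    have h2 := sum_injective_prod_X (ι := B) (univ : Finset C)
    simp only [mem_univ, implies_true, and_true, Fintype.card_coe, esymmOn_univ] at h2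
    rw [← h2, sum_filter]
    simp only [ha, IsEmpty.forall_iff, and_true]
  · have ha : a ∈ σ.part a := σ.mem_part_self.2 (mem_univ a)
    have h2 := sum_injective_prod_X_of_eq (⟨a, ha⟩ : σ.part a) i
    rw [Fintype.card_coe] at h2
    rw [blockSize, ← h2, sum_filter]
    simp only [ha, forall_true_left]

open Classical in
/-- The image of an expansion of `Y_G` when all variables commute but the colour of the vertex `a`
is remembered. -/
theorem sum_proper_prod_X_eq {G : SimpleGraph (Fin d)} {c : SetPartition d → ℚ}
    (h : Y G = ∑ σ, c σ • elementary σ) {N : ℕ} (a : Fin d) (i : Fin N) :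
    ∑ s : Fin d → Fin N with (∀ u v, G.Adj u v → s u ≠ s v) ∧ s a = i,
      ∏ j, (MvPolynomial.X (s j) : MvPolynomial (Fin N) ℚ) =
    ∑ σ : SetPartition d, c σ • ((∏ B ∈ σ.parts.erase (σ.part a),
      ((#B).factorial * MvPolynomial.esymm (Fin N) ℚ #B)) *
        (((blockSize σ a - 1).factorial : MvPolynomial (Fin N) ℚ) *
          markedEsymm i (blockSize σ a))) := by
  have key : ∀ s : Fin d → Fin N, (if ∀ u v, G.Adj u v → s u ≠ s v then 1 else 0 : ℚ) =
      ∑ σ, c σ * if InjOnParts σ s then 1 else 0 := by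
    intro s
    -- Both indicators depend only on which colours coincide, so the identity transfers along any
    -- injection of the N colours into the positive integers.
    have hinj : Function.Injective fun k : Fin N => (k : ℕ).succPNat :=
      Nat.succPNat_injective.comp Fin.val_injective
    have h1 := Y_eq_sum_elementary_iff.1 h fun j => (s j : ℕ).succPNat
    simp only [InjOnParts, ne_eq, hinj.eq_iff] at h1
    convert h1
    exact Iff.rfl
  simp only [← sum_injOnParts_prod_X]
  simp only [sum_filter, smul_sum]
  rw [sum_comm]
  refine sum_congr rfl fun s _ => ?_
  by_cases hs : s a = i
  · simp only [hs, and_true]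
    trans (if ∀ u v, G.Adj u v → s u ≠ s v then 1 else 0 : ℚ) •
      ∏ j, (MvPolynomial.X (s j) : MvPolynomial (Fin N) ℚ)
    · split_ifs <;> simp
    · rw [key, sum_smul]
      refine sum_congr rfl fun σ _ => ?_
      split_ifs <;> simp
  · simp [hs]

end Image

/-! ### Generating functions and the Euler operator -/

section GeneratingFunctions

variable {C : Type*} [DecidableEq C]

local notation "𝓡" => MvPolynomial C ℚ

/-- The power series `x_c z`. -/
noncomputable def linSeries (c : C) : PowerSeries 𝓡 :=
  PowerSeries.X * PowerSeries.C (MvPolynomial.X c)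

/-- The power series `x_c z / (1 + x_c z)`. -/
noncomputable def fracSeries (c : C) : PowerSeries 𝓡 :=
  linSeries c * PowerSeries.invOfUnit (1 + linSeries c) 1

/-- The product of the `1 + x_c z` over `c ∈ A`. -/
noncomputable def esymmSeries (A : Finset C) : PowerSeries 𝓡 :=
  ∏ c ∈ A, (1 + linSeries c)

/-- The derivation `z d/dz`. -/
noncomputable def eulerOp (f : PowerSeries 𝓡) : PowerSeries 𝓡 :=
  PowerSeries.X * PowerSeries.derivative (MvPolynomial C ℚ) f

omit [DecidableEq C] in
theorem one_add_linSeries_mul_invOfUnit (c : C) :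
    (1 + linSeries c) * PowerSeries.invOfUnit (1 + linSeries c) 1 = 1 :=
  PowerSeries.mul_invOfUnit _ _ (by simp [linSeries])

omit [DecidableEq C] in
theorem linSeries_mul_fracSeries (c : C) :
    linSeries c * fracSeries c = linSeries c - fracSeries c := by
  have h := one_add_linSeries_mul_invOfUnit c
  rw [fracSeries]
  linear_combination linSeries c * h

omit [DecidableEq C] in
theorem coeff_eulerOp (n : ℕ) (f : PowerSeries 𝓡) :
    PowerSeries.coeff n (eulerOp f) = n * PowerSeries.coeff n f := by
  cases n with
  | zero => simp [eulerOp]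
  | succ n =>
    rw [eulerOp, PowerSeries.coeff_succ_X_mul, PowerSeries.coeff_derivative]
    push_cast
    ring

omit [DecidableEq C] in
theorem eulerOp_mul (f g : PowerSeries 𝓡) :
    eulerOp (f * g) = eulerOp f * g + f * eulerOp g := by
  simp only [eulerOp, Derivation.leibniz, smul_eq_mul]
  ring

omit [DecidableEq C] in
theorem eulerOp_one_add_linSeries (c : C) : eulerOp (1 + linSeries c) = linSeries c := by
  simp [eulerOp, linSeries, Derivation.leibniz, PowerSeries.derivative_C]

/-- Logarithmic derivative of a product: each factor 1 + x_c z contributes x_c z / (1 + x_c z). -/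
theorem eulerOp_esymmSeries (A : Finset C) :
    eulerOp (esymmSeries A) = (∑ c ∈ A, fracSeries c) * esymmSeries A := by
  induction A using Finset.induction_on with
  | empty => simp [eulerOp, esymmSeries]
  | insert c A hc ih =>
    rw [esymmSeries, prod_insert hc, ← esymmSeries, eulerOp_mul, ih, eulerOp_one_add_linSeries,
      sum_insert hc]
    linear_combination -esymmSeries A * linSeries_mul_fracSeries c

omit [DecidableEq C] in
theorem eulerOp_fracSeries (c : C) :
    eulerOp (fracSeries c) = fracSeries c - fracSeries c ^ 2 := by
  have h := one_add_linSeries_mul_invOfUnit c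
  have h1 := linSeries_mul_fracSeries c
  have h2 := eulerOp_mul (1 + linSeries c) (fracSeries c)
  rw [show (1 + linSeries c) * fracSeries c = linSeries c by linear_combination h1,
    eulerOp_one_add_linSeries] at h2
  have h3 : eulerOp (linSeries c) = linSeries c := by
    simp [eulerOp, linSeries, Derivation.leibniz]
  rw [h3] at h2
  generalize PowerSeries.invOfUnit (1 + linSeries c) 1 = u at *
  linear_combination (-eulerOp (fracSeries c) + fracSeries c - fracSeries c ^ 2) * h
    - u * h2 + u * (fracSeries c - 1) * h1

omit [DecidableEq C] in
theorem coeff_esymmSeries (A : Finset C) (k : ℕ) :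
    PowerSeries.coeff k (esymmSeries A) = esymmOn A k := by
  classical
  have h : esymmSeries A =
      ∑ t ∈ A.powerset, PowerSeries.X ^ #t * PowerSeries.C (∏ c ∈ t, MvPolynomial.X c) := by
    rw [esymmSeries, prod_one_add]
    refine sum_congr rfl fun t _ => ?_
    simp only [linSeries]
    rw [prod_mul_distrib, prod_const, map_prod]
  rw [h, map_sum, esymmOn, powersetCard_eq_filter, sum_filter]
  refine sum_congr rfl fun t _ => ?_
  rw [PowerSeries.coeff_X_pow_mul']
  rcases lt_trichotomy #t k with hlt | rfl | hgt
  · rw [if_pos hlt.le, if_neg hlt.ne, PowerSeries.coeff_C, if_neg (by omega)]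
  · simp
  · rw [if_neg (by omega), if_neg hgt.ne']

variable [Fintype C]

/-- The denominator of `fracSeries i` cancels the factor of colour `i`, leaving x_i z times the
product over the other colours. -/
theorem coeff_esymmSeries_mul_fracSeries (i : C) (k : ℕ) :
    PowerSeries.coeff (k + 1) (esymmSeries univ * fracSeries i) = markedEsymm i (k + 1) := by
  have h : esymmSeries univ * fracSeries i =
      PowerSeries.X * (PowerSeries.C (MvPolynomial.X i) * esymmSeries (univ.erase i)) := by
    rw [esymmSeries, ← mul_prod_erase univ _ (mem_univ i), ← esymmSeries]
    have h1 := linSeries_mul_fracSeries i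
    rw [← mul_assoc, ← linSeries]
    linear_combination esymmSeries (univ.erase i) * h1
  rw [h, PowerSeries.coeff_succ_X_mul, PowerSeries.coeff_C_mul, coeff_esymmSeries]
  rfl

end GeneratingFunctions

/-! ### Colourings of a path with prescribed end colours -/

section Walks

variable {C : Type*} [DecidableEq C] [Fintype C]

local notation "𝓡" => MvPolynomial C ℚ

/-- The sum of the monomials of the proper colourings of a path with `n + 1` vertices whose ends
have the colours `b` and `c`. -/
noncomputable def walkPoly : ℕ → C → C → 𝓡
  | 0, b, c => if b = c then MvPolynomial.X c else 0
  | n + 1, b, c => ∑ c', if c' ≠ c then walkPoly n b c' * MvPolynomial.X c else 0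

/-- The generating function of the `walkPoly`s by the number of vertices. -/
noncomputable def walkSeries (b c : C) : PowerSeries 𝓡 :=
  PowerSeries.X * PowerSeries.mk fun n => walkPoly n b c

theorem walkSeries_eq (b c : C) :
    walkSeries b c = (if b = c then linSeries c else 0) +
      linSeries c * (∑ c', walkSeries b c' - walkSeries b c) := by
  have h : (PowerSeries.mk fun n => walkPoly n b c) =
      PowerSeries.C (if b = c then MvPolynomial.X c else 0) + PowerSeries.X *
        (PowerSeries.C (MvPolynomial.X c) * (∑ c', (PowerSeries.mk fun n => walkPoly n b c') -
          PowerSeries.mk fun n => walkPoly n b c)) := by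
    ext1 n
    cases n with
    | zero => simp [walkPoly]
    | succ n =>
      rw [map_add, PowerSeries.coeff_succ_X_mul, PowerSeries.coeff_C_mul, map_sub, map_sum,
        PowerSeries.coeff_C, if_neg n.succ_ne_zero, zero_add]
      simp only [PowerSeries.coeff_mk, walkPoly]
      rw [← add_sum_erase univ _ (mem_univ c), ← add_sum_erase univ (fun c' => walkPoly n b c')
        (mem_univ c), if_neg (by simp), add_sub_cancel_left, zero_add, mul_sum]
      refine sum_congr rfl fun c' hc' => ?_
      rw [if_pos (mem_erase.1 hc').1, mul_comm]
  conv_lhs => rw [walkSeries, h]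
  simp only [walkSeries, linSeries, ← mul_sum]
  split_ifs
  · ring
  · simp only [map_zero]
    ring

theorem walkSeries_eq_fracSeries_mul (b c : C) :
    walkSeries b c = fracSeries c * ((if b = c then 1 else 0) + ∑ c', walkSeries b c') := by
  have h := one_add_linSeries_mul_invOfUnit c
  have h1 := walkSeries_eq b c
  rw [fracSeries]
  generalize PowerSeries.invOfUnit (1 + linSeries c) 1 = u at *
  split_ifs at * <;> linear_combination -walkSeries b c * h + u * h1

/-- The series `1 - ∑ (k - 1) e_k z ^ k`. -/
noncomputable def denomSeries (C : Type*) [Fintype C] : PowerSeries (MvPolynomial C ℚ) :=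
  esymmSeries univ - eulerOp (esymmSeries univ)

/-- Let S be the sum of `walkSeries b c'` over all c'. Summing the recurrence gives (1 - ∑ f) S =
f_b, and E (1 - ∑ f) = E - θE is `denomSeries`. For b ≠ c the walk series is f_c S. -/
theorem denomSeries_mul_walkSeries {b c : C} (hbc : b ≠ c) :
    denomSeries C * walkSeries b c = esymmSeries univ * fracSeries b * fracSeries c := by
  have h1 : ∑ c', walkSeries b c' =
      fracSeries b + (∑ c', fracSeries c') * ∑ c', walkSeries b c' := by
    conv_lhs => rw [sum_congr rfl fun c' _ => walkSeries_eq_fracSeries_mul b c']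
    simp only [mul_add, sum_add_distrib, mul_ite, mul_one, mul_zero, sum_ite_eq, mem_univ,
      if_true, sum_mul]
  rw [walkSeries_eq_fracSeries_mul, if_neg hbc, denomSeries, eulerOp_esymmSeries]
  linear_combination esymmSeries univ * fracSeries c * h1

/-- The last term restores what is subtracted twice when `b = i`. That case does occur, as v_2 and
the last vertex are not adjacent. -/
theorem sum_ite_ne_and_ne {R : Type*} [CommRing R] (f : C → R) (i b : C) :
    ∑ a, (if a ≠ i ∧ a ≠ b then f a else 0) =
      ∑ a, f a - f i - f b + if b = i then f i else 0 := by
  have h : ∀ a, (if a ≠ i ∧ a ≠ b then f a else 0) = f a - (if i = a then f a else 0) -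
      (if b = a then f a else 0) + if i = a then (if b = i then f i else 0) else 0 := by
    intro a
    by_cases h1 : a = i <;> by_cases h2 : a = b
    · subst h1
      subst h2
      simp
    · subst h1
      simp [h2, Ne.symm h2]
    · subst h2
      simp [h1, Ne.symm h1]
    · simp [h1, h2, Ne.symm h1, Ne.symm h2]
  simp only [h, sum_add_distrib, sum_sub_distrib, sum_ite_eq, mem_univ, if_true]

end Walks

/-! ### The generating function of the cycle-chord graphs -/

section MarkedSeries

variable {C : Type*} [DecidableEq C] [Fintype C]

/-- The generating function of the sums over the colourings of the cycle-chord graphs whose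
last vertex has the colour `i`; `a`, `b`, `c` are the colours of its first, second and
penultimate vertices. -/
noncomputable def markedSeries (i : C) : PowerSeries (MvPolynomial C ℚ) :=
  ∑ b, ∑ c, ∑ a, if a ≠ i ∧ a ≠ b then if c ≠ i ∧ c ≠ b then
    PowerSeries.C (MvPolynomial.X i * MvPolynomial.X a) * walkSeries b c else 0 else 0

/-- In `markedSeries` the exponent of z counts only the path vertices v_2, …, v_{m+1}; the factor z²
makes the first and last vertices count too, turning x_a and x_i into `linSeries`. -/
theorem X_sq_mul_denomSeries_mul_markedSeries (i : C) :
    PowerSeries.X ^ 2 * (denomSeries C * markedSeries i) =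
      esymmSeries univ * linSeries i * ∑ b, fracSeries b *
        ((∑ c, fracSeries c - fracSeries i - fracSeries b + if b = i then fracSeries i else 0) *
        (∑ c, linSeries c - linSeries i - linSeries b + if b = i then linSeries i else 0)) := by
  simp only [← sum_ite_ne_and_ne, markedSeries, sum_mul_sum]
  simp only [mul_sum]
  refine sum_congr rfl fun b _ => sum_congr rfl fun c _ => sum_congr rfl fun a _ => ?_
  by_cases h1 : a ≠ i ∧ a ≠ b
  · by_cases h2 : c ≠ i ∧ c ≠ b
    · rw [if_pos h1, if_pos h2, if_pos h2, if_pos h1, linSeries, linSeries, map_mul]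
      linear_combination PowerSeries.X ^ 2 * PowerSeries.C (MvPolynomial.X i) *
        PowerSeries.C (MvPolynomial.X a) * denomSeries_mul_walkSeries (Ne.symm h2.2)
    · simp [h2]
  · simp [h1]

theorem sum_fracSeries_mul_mul (i : C) :
    ∑ b, fracSeries b *
        ((∑ c, fracSeries c - fracSeries i - fracSeries b + if b = i then fracSeries i else 0) *
        (∑ c, linSeries c - linSeries i - linSeries b + if b = i then linSeries i else 0)) =
      (∑ c, linSeries c - linSeries i) * ((∑ c, fracSeries c) ^ 2 - ∑ c, fracSeries c ^ 2
        - fracSeries i * (∑ c, fracSeries c - fracSeries i))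
      - ((∑ c, linSeries c * fracSeries c - linSeries i * fracSeries i) *
          (∑ c, fracSeries c - fracSeries i)
        - (∑ c, linSeries c * fracSeries c ^ 2 - linSeries i * fracSeries i ^ 2)) := by
  generalize hp : ∑ c : C, fracSeries c = p
  generalize he : ∑ c : C, linSeries c = e
  have h : ∀ b : C, fracSeries b *
        ((p - fracSeries i - fracSeries b + if b = i then fracSeries i else 0) *
        (e - linSeries i - linSeries b + if b = i then linSeries i else 0)) =
      (p - fracSeries i) * (e - linSeries i) * fracSeries b
        - (p - fracSeries i) * (linSeries b * fracSeries b)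
        - (e - linSeries i) * fracSeries b ^ 2 + linSeries b * fracSeries b ^ 2
        + if b = i then fracSeries i * ((p - fracSeries i) * (e - linSeries i) -
          (p - 2 * fracSeries i) * (e - 2 * linSeries i)) else 0 := by
    intro b
    split_ifs with hb
    · subst hb
      ring
    · ring
  rw [sum_congr rfl fun b _ => h b]
  simp only [sum_add_distrib, sum_sub_distrib, ← mul_sum, sum_ite_eq', mem_univ, if_true, hp]
  ring

/-- With p = ∑ f_c and q = ∑ f_c², one has θE = pE, θ²E = (p² + p - q)E and θ(E f_i) = (p + 1 - f_i)
E f_i. Together with x_c z f_c = x_c z - f_c, these rewrite everything in terms of E, E f_i and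
their images under θ, whose coefficients are known. -/
theorem X_sq_mul_denomSeries_mul_markedSeries_eq_eulerOp (i : C) :
    PowerSeries.X ^ 2 * (denomSeries C * markedSeries i) =
      linSeries i * (∑ c, linSeries c - linSeries i) *
        (eulerOp (eulerOp (esymmSeries univ)) - 3 * eulerOp (esymmSeries univ) +
          3 * esymmSeries univ) +
      linSeries i * (eulerOp (eulerOp (esymmSeries univ)) - 5 * eulerOp (esymmSeries univ) +
          6 * esymmSeries univ) +
      (∑ c, linSeries c) * (eulerOp (esymmSeries univ * fracSeries i) -
        3 * (esymmSeries univ * fracSeries i)) +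
      (3 * eulerOp (esymmSeries univ * fracSeries i) -
        9 * (esymmSeries univ * fracSeries i)) := by
  rw [X_sq_mul_denomSeries_mul_markedSeries, sum_fracSeries_mul_mul]
  have hp : eulerOp (∑ c : C, fracSeries c) = ∑ c, fracSeries c - ∑ c, fracSeries c ^ 2 := by
    rw [← sum_sub_distrib, ← sum_congr rfl fun c _ => eulerOp_fracSeries c]
    simp only [eulerOp, map_sum, mul_sum]
  have h1 : ∑ c : C, linSeries c * fracSeries c = ∑ c, linSeries c - ∑ c, fracSeries c := by
    rw [← sum_sub_distrib, sum_congr rfl fun c _ => linSeries_mul_fracSeries c]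
  have h2 : ∑ c : C, linSeries c * fracSeries c ^ 2 =
      ∑ c, linSeries c - ∑ c, fracSeries c - ∑ c, fracSeries c ^ 2 := by
    rw [← h1, ← sum_sub_distrib]
    refine sum_congr rfl fun c _ => ?_
    linear_combination fracSeries c * linSeries_mul_fracSeries c
  rw [h1, h2, eulerOp_mul, eulerOp_fracSeries, eulerOp_esymmSeries, eulerOp_mul, hp,
    eulerOp_esymmSeries]
  have hy := linSeries_mul_fracSeries i
  generalize ∑ c : C, fracSeries c ^ 2 = q at *
  generalize ∑ c : C, fracSeries c = p at *
  generalize ∑ c : C, linSeries c = e at *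
  generalize fracSeries i = y at *
  generalize linSeries i = a at *
  generalize esymmSeries (univ : Finset C) = E at *
  grind

/-- The coefficients of `denomSeries * markedSeries`. -/
theorem coeff_denomSeries_mul_markedSeries (i : C) (n : ℕ) :
    PowerSeries.coeff n (denomSeries C * markedSeries i) =
      ((n : MvPolynomial C ℚ) ^ 2 - 3 * n + 3) * MvPolynomial.esymm C ℚ n * markedEsymm i 2 +
      ((n : MvPolynomial C ℚ) ^ 2 - 3 * n + 2) * MvPolynomial.esymm C ℚ (n + 1) *
        markedEsymm i 1 +
      ((n : MvPolynomial C ℚ) - 2) * MvPolynomial.esymm C ℚ 1 * markedEsymm i (n + 1) +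
      (3 * (n : MvPolynomial C ℚ) - 3) * markedEsymm i (n + 2) := by
  have h1 : linSeries i * (∑ c : C, linSeries c - linSeries i) =
      PowerSeries.X ^ 2 * PowerSeries.C (markedEsymm i 2) := by
    rw [← sum_erase_eq_sub (mem_univ i)]
    simp only [markedEsymm, esymmOn, Nat.add_one_sub_one, powersetCard_one, sum_map, linSeries,
      ← mul_sum, ← map_sum, map_mul, Function.Embedding.coeFn_mk, prod_singleton]
    ring
  have h2 : linSeries i = PowerSeries.X * PowerSeries.C (markedEsymm i 1) := by
    simp [markedEsymm, esymmOn, linSeries]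
  have h3 : ∑ c : C, linSeries c = PowerSeries.X * PowerSeries.C (MvPolynomial.esymm C ℚ 1) := by
    simp only [linSeries, ← mul_sum, ← map_sum, MvPolynomial.esymm_one]
  have h := congrArg (PowerSeries.coeff (n + 2)) (X_sq_mul_denomSeries_mul_markedSeries_eq_eulerOp i)
  rw [PowerSeries.coeff_X_pow_mul, h1, h2, h3] at h
  rw [h]
  have hnum : ∀ (k : ℕ) (f : PowerSeries (MvPolynomial C ℚ)) (j : ℕ),
      PowerSeries.coeff j ((k : PowerSeries (MvPolynomial C ℚ)) * f) =
        k * PowerSeries.coeff j f := by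
    intro k f j
    rw [← nsmul_eq_mul, map_nsmul, nsmul_eq_mul]
  have hn3 := hnum 3
  have hn5 := hnum 5
  have hn6 := hnum 6
  have hn9 := hnum 9
  push_cast at hn3 hn5 hn6 hn9
  simp only [map_add, mul_assoc, PowerSeries.coeff_X_pow_mul, PowerSeries.coeff_succ_X_mul,
    PowerSeries.coeff_C_mul, map_sub, coeff_eulerOp, coeff_esymmSeries, hn3, hn5, hn6, hn9,
    coeff_esymmSeries_mul_fracSeries, esymmOn_univ]
  push_cast
  ring

end MarkedSeries

/-! ### Colourings of the cycle-chord graph -/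

section Colourings

variable {C : Type*} [DecidableEq C] [Fintype C]

theorem ite_sum_zero {ι R : Type*} [AddCommMonoid R] (p : Prop) [Decidable p] (t : Finset ι)
    (f : ι → R) : (if p then ∑ x ∈ t, f x else 0) = ∑ x ∈ t, if p then f x else 0 := by
  split_ifs <;> simp

omit [DecidableEq C] [Fintype C] in
theorem forall_snoc_ne_iff {n : ℕ} (f : Fin (n + 1) → C) (c : C) :
    (∀ j : Fin (n + 1), (Fin.snoc f c : Fin (n + 2) → C) j.castSucc ≠
      (Fin.snoc f c : Fin (n + 2) → C) j.succ) ↔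
      (∀ j : Fin n, f j.castSucc ≠ f j.succ) ∧ f (Fin.last n) ≠ c := by
  rw [Fin.forall_fin_succ']
  simp only [Fin.snoc_castSucc, Fin.succ_last, Fin.snoc_last, Fin.succ_castSucc]

/-- The weight `F` of the end colours is arbitrary so that, in the induction, the last vertex can be
removed and absorbed into the weight of the shorter path. -/
theorem sum_path_prod_X (n : ℕ) (F : C → C → MvPolynomial C ℚ) :
    ∑ f : Fin (n + 1) → C, (if ∀ j : Fin n, f j.castSucc ≠ f j.succ then
      (∏ j, MvPolynomial.X (f j)) * F (f 0) (f (Fin.last n)) else 0) =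
    ∑ b, ∑ c, walkPoly n b c * F b c := by
  induction n generalizing F with
  | zero =>
    rw [← (Equiv.funUnique (Fin 1) C).symm.sum_comp]
    refine sum_congr rfl fun b _ => ?_
    simp [walkPoly, ite_mul]
  | succ n ih =>
    rw [← (Fin.snocEquiv fun _ : Fin (n + 2) => C).sum_comp, Fintype.sum_prod_type, sum_comm]
    trans ∑ f : Fin (n + 1) → C, (if ∀ j : Fin n, f j.castSucc ≠ f j.succ then
      (∏ j, MvPolynomial.X (f j)) * ∑ c, (if f (Fin.last n) ≠ c then
        MvPolynomial.X c * F (f 0) c else 0) else 0)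
    · refine sum_congr rfl fun f _ => ?_
      rw [mul_sum, ite_sum_zero]
      · refine sum_congr rfl fun c _ => ?_
        have h0 : (Fin.snoc f c : Fin (n + 2) → C) 0 = f 0 :=
          Fin.snoc_castSucc (α := fun _ => C) c f 0
        have hprod : (∏ j, MvPolynomial.X ((Fin.snoc f c : Fin (n + 2) → C) j) :
            MvPolynomial C ℚ) = (∏ j, MvPolynomial.X (f j)) * MvPolynomial.X c := by
          rw [Fin.prod_univ_castSucc]
          simp only [Fin.snoc_castSucc, Fin.snoc_last]
        simp only [Fin.snocEquiv, Equiv.coe_fn_mk, forall_snoc_ne_iff, h0, hprod, Fin.snoc_last]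
        by_cases h1 : ∀ j : Fin n, f j.castSucc ≠ f j.succ
        · by_cases h2 : f (Fin.last n) ≠ c
          · rw [if_pos ⟨h1, h2⟩, if_pos h1, if_pos h2, mul_assoc]
          · rw [if_neg fun h => h2 h.2, if_pos h1, if_neg h2, mul_zero]
        · rw [if_neg fun h => h1 h.1, if_neg h1]
    · rw [ih fun b c' => ∑ c, if c' ≠ c then MvPolynomial.X c * F b c else 0]
      refine sum_congr rfl fun b _ => ?_
      simp only [walkPoly, mul_sum, sum_mul]
      rw [sum_comm]
      refine sum_congr rfl fun c _ => sum_congr rfl fun c' _ => ?_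
      split_ifs
      · ring
      · ring

theorem forall_adj_cycleChordThree_iff {α : Type*} {n : ℕ} (hn : 2 ≤ n) (s : Fin (n + 1 + 2) → α) :
    (∀ u v, (cycleChordThree (n + 1)).Adj u v → s u ≠ s v) ↔
      (∀ j : Fin (n + 2), s j.castSucc ≠ s j.succ) ∧ s 0 ≠ s (Fin.last (n + 2)) ∧
        s ⟨1, by omega⟩ ≠ s ⟨n + 1, by omega⟩ := by
  have hadj : ∀ u v, (cycleChordThree (n + 1)).Adj u v ↔
      (u.val = v.val + 1 ∨ v.val = u.val + 1 ∨ (u.val = 0 ∧ v.val = n + 2) ∨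
        (v.val = 0 ∧ u.val = n + 2)) ∨
      ((u.val = 1 ∧ v.val = n + 1) ∨ (u.val = n + 1 ∧ v.val = 1)) := by
    have hsub : ∀ u v : Fin (n + 1 + 2), (u - v).val = 1 ↔
        u.val = v.val + 1 ∨ (u.val = 0 ∧ v.val = n + 2) := by
      intro u v
      have hu := u.2
      have hv := v.2
      rcases le_or_gt v u with h | h
      · rw [Fin.coe_sub_iff_le.2 h]
        have := Fin.le_def.1 h
        omega
      · rw [Fin.coe_sub_iff_lt.2 h]
        have := Fin.lt_def.1 h
        omega
    intro u v
    rw [cycleChordThree, SimpleGraph.sup_adj, SimpleGraph.cycleGraph_adj', SimpleGraph.edge_adj,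
      hsub, hsub]
    simp only [Fin.ext_iff]
    omega
  simp only [hadj]
  constructor
  · intro h
    refine ⟨fun j => h _ _ ?_, h _ _ ?_, h _ _ ?_⟩
    · simp
    · simp
    · simp
  · rintro ⟨h1, h2, h3⟩ u v huv
    have key : ∀ u v : Fin (n + 1 + 2), (v.val = u.val + 1 ∨ (u.val = 0 ∧ v.val = n + 2) ∨
        (u.val = 1 ∧ v.val = n + 1)) → s u ≠ s v := by
      rintro u v (h | ⟨hu, hv⟩ | ⟨hu, hv⟩)
      · have hv := v.2
        have := h1 ⟨u, by omega⟩
        rwa [show (⟨u, by omega⟩ : Fin (n + 2)).castSucc = u from rfl,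
          show (⟨u, by omega⟩ : Fin (n + 2)).succ = v from Fin.ext h.symm] at this
      · rwa [show u = 0 from Fin.ext hu, show v = Fin.last (n + 2) from Fin.ext hv]
      · have hu' : u = ⟨1, by omega⟩ := Fin.ext hu
        have hv' : v = ⟨n + 1, by omega⟩ := Fin.ext hv
        simpa only [hu', hv'] using h3
    rcases huv with (h | h | h | h) | (h | h)
    · exact (key v u (Or.inl h)).symm
    · exact key u v (Or.inl h)
    · exact key u v (Or.inr (Or.inl h))
    · exact (key v u (Or.inr (Or.inl h))).symm
    · exact key u v (Or.inr (Or.inr h))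
    · exact (key v u (Or.inr (Or.inr h.symm))).symm

open Classical in
theorem sum_proper_cycleChordThree {n : ℕ} (hn : 2 ≤ n) (i : C) :
    ∑ s : Fin (n + 1 + 2) → C with
      (∀ u v, (cycleChordThree (n + 1)).Adj u v → s u ≠ s v) ∧ s (Fin.last (n + 2)) = i,
      ∏ j, (MvPolynomial.X (s j) : MvPolynomial C ℚ) =
    PowerSeries.coeff (n + 1) (markedSeries i) := by
  have hR : PowerSeries.coeff (n + 1) (markedSeries i) = ∑ b, ∑ c, walkPoly n b c *
      ∑ a, if a ≠ i ∧ a ≠ b ∧ c ≠ i ∧ c ≠ b then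
        MvPolynomial.X i * MvPolynomial.X a else 0 := by
    rw [markedSeries, map_sum]
    refine sum_congr rfl fun b _ => ?_
    rw [map_sum]
    refine sum_congr rfl fun c _ => ?_
    rw [map_sum, mul_sum]
    refine sum_congr rfl fun a _ => ?_
    by_cases h1 : a ≠ i ∧ a ≠ b
    · by_cases h2 : c ≠ i ∧ c ≠ b
      · rw [if_pos h1, if_pos h2, if_pos ⟨h1.1, h1.2, h2⟩, PowerSeries.coeff_C_mul, walkSeries,
          PowerSeries.coeff_succ_X_mul, PowerSeries.coeff_mk, mul_comm]
      · rw [if_pos h1, if_neg h2, if_neg fun h => h2 h.2.2, map_zero, mul_zero]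
    · rw [if_neg h1, if_neg fun h => h1 ⟨h.1, h.2.1⟩, map_zero, mul_zero]
  rw [hR, ← sum_path_prod_X n fun b c => ∑ a, if a ≠ i ∧ a ≠ b ∧ c ≠ i ∧ c ≠ b then
        MvPolynomial.X i * MvPolynomial.X a else 0]
  -- A colouring is split into the colour `a` of v_1, the colouring `f` of the path v_2 … v_{m+1},
  -- and the colour `c` of v_{m+2}, which must be `i`.
  rw [sum_filter, ← (Fin.consEquiv fun _ : Fin (n + 1 + 2) => C).sum_comp,
    Fintype.sum_prod_type, sum_comm, ← (Fin.snocEquiv fun _ : Fin (n + 2) => C).sum_comp,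
    Fintype.sum_prod_type, sum_comm]
  refine sum_congr rfl fun f _ => ?_
  rw [sum_comm, mul_sum, ite_sum_zero]
  refine sum_congr rfl fun a _ => ?_
  have hcond : ∀ c : C, ((∀ u v, (cycleChordThree (n + 1)).Adj u v →
      (Fin.cons a (Fin.snoc f c : Fin (n + 2) → C) : Fin (n + 1 + 2) → C) u ≠
      (Fin.cons a (Fin.snoc f c : Fin (n + 2) → C) : Fin (n + 1 + 2) → C) v) ∧
      (Fin.cons a (Fin.snoc f c : Fin (n + 2) → C) : Fin (n + 1 + 2) → C) (Fin.last (n + 2)) = i) ↔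
      c = i ∧ (∀ j : Fin n, f j.castSucc ≠ f j.succ) ∧
        (a ≠ i ∧ a ≠ f 0 ∧ f (Fin.last n) ≠ i ∧ f (Fin.last n) ≠ f 0) := by
    intro c
    rw [forall_adj_cycleChordThree_iff hn]
    have h1 : (Fin.cons a (Fin.snoc f c : Fin (n + 2) → C) : Fin (n + 1 + 2) → C)
        (⟨1, by omega⟩ : Fin (n + 2)).castSucc = f 0 := by
      have : (⟨1, by omega⟩ : Fin (n + 2)).castSucc = (0 : Fin (n + 1)).castSucc.succ := rfl
      rw [this, Fin.cons_succ, Fin.snoc_castSucc]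
    have h2 : (Fin.cons a (Fin.snoc f c : Fin (n + 2) → C) : Fin (n + 1 + 2) → C)
        (⟨n + 1, by omega⟩ : Fin (n + 2)).castSucc = f (Fin.last n) := by
      have : (⟨n + 1, by omega⟩ : Fin (n + 2)).castSucc = (Fin.last n).castSucc.succ := rfl
      rw [this, Fin.cons_succ, Fin.snoc_castSucc]
    have h3 : (Fin.cons a (Fin.snoc f c : Fin (n + 2) → C) : Fin (n + 1 + 2) → C)
        (Fin.last (n + 2)) = c := by
      rw [← Fin.succ_last, Fin.cons_succ, Fin.snoc_last]
    have h4 : (∀ j : Fin (n + 2), (Fin.cons a (Fin.snoc f c : Fin (n + 2) → C) :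
        Fin (n + 1 + 2) → C) j.castSucc ≠ (Fin.cons a (Fin.snoc f c : Fin (n + 2) → C) :
        Fin (n + 1 + 2) → C) j.succ) ↔
        a ≠ f 0 ∧ (∀ j : Fin n, f j.castSucc ≠ f j.succ) ∧ f (Fin.last n) ≠ c := by
      rw [Fin.forall_fin_succ]
      have h0 : (Fin.snoc f c : Fin (n + 2) → C) 0 = f 0 :=
        Fin.snoc_castSucc (α := fun _ => C) c f 0
      simp only [Fin.castSucc_zero, Fin.cons_zero, Fin.cons_succ, ← Fin.succ_castSucc, h0,
        forall_snoc_ne_iff]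
    simp only [Fin.castSucc_mk] at h1 h2
    rw [h1, h2, h3, h4, Fin.cons_zero]
    grind
  have hprod : ∀ c : C, (∏ j, MvPolynomial.X ((Fin.cons a (Fin.snoc f c : Fin (n + 2) → C) :
      Fin (n + 1 + 2) → C) j) : MvPolynomial C ℚ) =
      (∏ j, MvPolynomial.X (f j)) * (MvPolynomial.X c * MvPolynomial.X a) := by
    intro c
    rw [Fin.prod_univ_succ, Fin.prod_univ_castSucc]
    simp only [Fin.cons_zero, Fin.cons_succ, Fin.snoc_castSucc, Fin.snoc_last]
    ring
  refine (sum_congr rfl fun c _ => if_congr (hcond c) (hprod c) rfl).trans ?_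
  rw [sum_eq_single i]
  · by_cases hP : ∀ j : Fin n, f j.castSucc ≠ f j.succ
    · by_cases hD : a ≠ i ∧ a ≠ f 0 ∧ f (Fin.last n) ≠ i ∧ f (Fin.last n) ≠ f 0
      · rw [if_pos ⟨rfl, hP, hD⟩, if_pos hP, if_pos hD]
      · rw [if_neg fun h => hD h.2.2, if_pos hP, if_neg hD, mul_zero]
    · rw [if_neg fun h => hP h.2.1, if_neg hP]
  · intro c _ hc
    rw [if_neg fun h => hc h.1]
  · intro h
    exact absurd (mem_univ i) h

end Colourings

/-! ### Independence of the marked elementary functions -/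

section Independence

variable {N : ℕ}

theorem esymmOn_erase_succ (i : Fin N) (k : ℕ) :
    esymmOn (univ.erase i) (k + 1) =
      MvPolynomial.esymm (Fin N) ℚ (k + 1) - MvPolynomial.X i * esymmOn (univ.erase i) k := by
  have h := congrArg (PowerSeries.coeff (k + 1))
    (mul_prod_erase univ (fun c : Fin N => 1 + linSeries c) (mem_univ i))
  rw [← esymmSeries, ← esymmSeries, add_mul, one_mul, map_add, linSeries, mul_assoc,
    PowerSeries.coeff_succ_X_mul, PowerSeries.coeff_C_mul] at h
  simp only [coeff_esymmSeries, esymmOn_univ] at h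
  rw [← h, add_sub_cancel_right]

theorem esymmOn_zero {C : Type*} (A : Finset C) : esymmOn A 0 = 1 := by
  simp [esymmOn]

/-- The polynomial in `x_i`, with symmetric coefficients, that gives the elementary symmetric
polynomials in the variables other than `x_i`. -/
noncomputable def erasePoly (N : ℕ) : ℕ → Polynomial (MvPolynomial (Fin N) ℚ)
  | 0 => 1
  | k + 1 => Polynomial.C (MvPolynomial.esymm (Fin N) ℚ (k + 1)) - Polynomial.X * erasePoly N k

theorem eval_erasePoly (i : Fin N) (k : ℕ) :
    (erasePoly N k).eval (MvPolynomial.X i) = esymmOn (univ.erase i) k := by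
  induction k with
  | zero => simp [erasePoly, esymmOn_zero]
  | succ k ih => simp [erasePoly, ih, esymmOn_erase_succ]

theorem degree_erasePoly_le (k : ℕ) : (erasePoly N k).degree ≤ k := by
  induction k with
  | zero => simp [erasePoly]
  | succ k ih =>
    rw [erasePoly]
    refine (Polynomial.degree_sub_le _ _).trans (max_le ?_ ?_)
    · exact Polynomial.degree_C_le.trans (by exact_mod_cast Nat.zero_le _)
    · rw [mul_comm, Polynomial.degree_mul_X]
      push_cast
      gcongr

theorem coeff_erasePoly_self (k : ℕ) : (erasePoly N k).coeff k = (-1) ^ k := by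
  induction k with
  | zero => simp [erasePoly]
  | succ k ih =>
    rw [erasePoly, Polynomial.coeff_sub, Polynomial.coeff_C_succ, Polynomial.coeff_X_mul, ih,
      pow_succ]
    ring

theorem degree_sum_erasePoly_lt (a : ℕ → MvPolynomial (Fin N) ℚ) (n : ℕ) :
    (∑ b ∈ range n, Polynomial.C (a b) * erasePoly N b).degree < n := by
  refine (Polynomial.degree_sum_le _ _).trans_lt ((Finset.sup_lt_iff (WithBot.bot_lt_coe n)).2 ?_)
  intro b hb
  refine (Polynomial.degree_mul_le _ _).trans_lt ?_
  refine (add_le_add Polynomial.degree_C_le (degree_erasePoly_le b)).trans_lt ?_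
  rw [zero_add]
  exact WithBot.coe_lt_coe.2 (mem_range.1 hb)

theorem eq_zero_of_sum_erasePoly_eq_zero {a : ℕ → MvPolynomial (Fin N) ℚ} (n : ℕ)
    (h : ∑ b ∈ range n, Polynomial.C (a b) * erasePoly N b = 0) : ∀ b < n, a b = 0 := by
  induction n with
  | zero => simp
  | succ n ih =>
    have hn : a n = 0 := by
      have h1 := congrArg (fun p => Polynomial.coeff p n) h
      simp only [sum_range_succ, Polynomial.coeff_add, Polynomial.coeff_C_mul,
        coeff_erasePoly_self, Polynomial.coeff_zero] at h1
      rw [Polynomial.coeff_eq_zero_of_degree_lt (degree_sum_erasePoly_lt a n), zero_add] at h1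
      exact (mul_eq_zero.1 h1).resolve_right (pow_ne_zero _ (by simp))
    rw [sum_range_succ, hn, Polynomial.C_0, zero_mul, add_zero] at h
    intro b hb
    rcases Nat.lt_succ_iff_lt_or_eq.1 hb with hb | rfl
    · exact ih h b hb
    · exact hn

/-- After cancelling x_i, the hypothesis says that one polynomial of degree less than N, with
coefficients not depending on `i`, vanishes at the N distinct points x_i. It is therefore zero, and
as `erasePoly N b` has degree `b` and leading coefficient ±1, all `a b` vanish. -/
theorem eq_zero_of_sum_markedEsymm_eq_zero {a : ℕ → MvPolynomial (Fin N) ℚ}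
    (h : ∀ i : Fin N, ∑ b ∈ range N, a b * markedEsymm i (b + 1) = 0) : ∀ b < N, a b = 0 := by
  refine eq_zero_of_sum_erasePoly_eq_zero N ?_
  refine Polynomial.eq_zero_of_degree_lt_of_eval_index_eq_zero (univ : Finset (Fin N))
    (v := fun i => (MvPolynomial.X i : MvPolynomial (Fin N) ℚ))
    (fun i _ j _ hij => MvPolynomial.X_injective hij) ?_ ?_
  · simpa using degree_sum_erasePoly_lt a N
  · intro i _
    have h1 := h i
    simp only [markedEsymm, Nat.add_sub_cancel, mul_left_comm _ (MvPolynomial.X i)] at h1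
    rw [← mul_sum] at h1
    have h2 := (mul_eq_zero.1 h1).resolve_left (MvPolynomial.X_ne_zero i)
    simpa [Polynomial.eval_finsetSum, eval_erasePoly] using h2

/-- The substitution of the elementary symmetric polynomials for the variables. -/
noncomputable def substEsymm (N : ℕ) : MvPolynomial (Fin N) ℚ →ₐ[ℚ] MvPolynomial (Fin N) ℚ :=
  MvPolynomial.aeval fun k : Fin N => MvPolynomial.esymm (Fin N) ℚ (k + 1)

/-- Algebraic independence of e_1, …, e_N, from the fundamental theorem on symmetric polynomials. It
allows positivity to be tested on formal variables. -/
theorem substEsymm_injective : Function.Injective (substEsymm N) := by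
  have h : substEsymm N = (Subalgebra.val _).comp (MvPolynomial.esymmAlgHom (Fin N) ℚ N) := by
    ext1 k
    simp [substEsymm, MvPolynomial.esymmAlgHom]
  rw [h]
  exact Subtype.val_injective.comp (MvPolynomial.esymmAlgHom_injective ℚ (by simp))

/-- The polynomial that becomes the `k`-th elementary symmetric one under `substEsymm`. -/
noncomputable def esymmVar (N : ℕ) : ℕ → MvPolynomial (Fin N) ℚ
  | 0 => 1
  | k + 1 => if h : k < N then MvPolynomial.X ⟨k, h⟩ else 0

theorem substEsymm_esymmVar (k : ℕ) :
    substEsymm N (esymmVar N k) = MvPolynomial.esymm (Fin N) ℚ k := by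
  cases k with
  | zero => simp [esymmVar, MvPolynomial.esymm_zero]
  | succ k =>
    rw [esymmVar]
    split_ifs with h
    · simp [substEsymm]
    · rw [map_zero, MvPolynomial.esymm, powersetCard_eq_empty.2 (by simp; omega), sum_empty]

/-- The polynomials with nonnegative coefficients. -/
def nonnegCoeffs (σ : Type*) : Subsemiring (MvPolynomial σ ℚ) where
  carrier := {p | ∀ u, 0 ≤ p.coeff u}
  mul_mem' := by
    classical
    intro p q hp hq u
    rw [MvPolynomial.coeff_mul]
    exact sum_nonneg fun x _ => mul_nonneg (hp _) (hq _)
  one_mem' := by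
    classical
    intro u
    rw [MvPolynomial.coeff_one]
    split_ifs <;> norm_num
  add_mem' := by
    intro p q hp hq u
    rw [MvPolynomial.coeff_add]
    exact add_nonneg (hp u) (hq u)
  zero_mem' := by
    intro u
    rw [MvPolynomial.coeff_zero]

theorem esymmVar_mem_nonnegCoeffs (k : ℕ) : esymmVar N k ∈ nonnegCoeffs (Fin N) := by
  cases k with
  | zero => exact one_mem _
  | succ k =>
    rw [esymmVar]
    split_ifs with h
    · intro u
      rw [MvPolynomial.coeff_X]
      split_ifs <;> norm_num
    · exact zero_mem _

end Independence

/-! ### Reading off class coefficients -/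

section Criterion

variable {d : ℕ}

/-- The multiset of the sizes of the blocks that do not contain `a`. -/
def restType (a : Fin d) (σ : SetPartition d) : Multiset ℕ :=
  (σ.parts.erase (σ.part a)).val.map Finset.card

theorem blockType_eq_cons (a : Fin d) (σ : SetPartition d) :
    blockType σ = blockSize σ a ::ₘ restType a σ := by
  rw [blockType, restType, blockSize, ← Multiset.map_cons, erase_val,
    Multiset.cons_erase (σ.part_mem.2 (mem_univ a) : σ.part a ∈ σ.parts.val)]

theorem congrMod_iff {a : Fin d} {π σ : SetPartition d} :
    CongrMod a π σ ↔ blockSize π a = blockSize σ a ∧ restType a π = restType a σ := by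
  rw [CongrMod, blockType_eq_cons a, blockType_eq_cons a]
  constructor
  · rintro ⟨h1, h2⟩
    rw [h2] at h1
    exact ⟨h2, (Multiset.cons_inj_right _).1 h1⟩
  · rintro ⟨h1, h2⟩
    rw [h1, h2]
    exact ⟨rfl, rfl⟩

theorem restType_bounds {a : Fin d} {σ : SetPartition d} {k : ℕ} (hk : k ∈ restType a σ) :
    0 < k ∧ k ≤ d := by
  obtain ⟨B, hB, rfl⟩ := Multiset.mem_map.1 hk
  refine ⟨card_pos.2 (σ.nonempty_of_mem_parts (mem_erase.1 hB).2), ?_⟩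
  simpa using card_le_univ B

/-- The number of ways to arrange the blocks' elements, the one of `a` being first in its block. -/
def arrangements (a : Fin d) (σ : SetPartition d) : ℕ :=
  ((restType a σ).map Nat.factorial).prod * (blockSize σ a - 1).factorial

variable [NeZero d]

/-- The exponent of the monomial of the blocks that do not contain `a`. -/
noncomputable def restExponent (a : Fin d) (σ : SetPartition d) : Fin d →₀ ℕ :=
  Multiset.toFinsupp ((restType a σ).map fun k => Fin.ofNat d (k - 1))

theorem restExponent_inj {a : Fin d} {π σ : SetPartition d} :
    restExponent a π = restExponent a σ ↔ restType a π = restType a σ := by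
  refine ⟨fun h => ?_, fun h => by rw [restExponent, h, restExponent]⟩
  have h1 := congrArg (Multiset.map fun k : Fin d => (k : ℕ) + 1) (Multiset.toFinsupp.injective h)
  have h2 : ∀ σ : SetPartition d, ((restType a σ).map fun k => Fin.ofNat d (k - 1)).map
      (fun k : Fin d => (k : ℕ) + 1) = restType a σ := by
    intro σ
    rw [Multiset.map_map]
    conv_rhs => rw [← Multiset.map_id' (restType a σ)]
    refine Multiset.map_congr rfl fun k hk => ?_
    -- Sizes lie between 1 and d, so neither the truncated `k - 1` nor the reduction modulo d loses
    -- information.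
    have := restType_bounds hk
    simp only [Function.comp_apply, Fin.val_ofNat]
    rw [Nat.mod_eq_of_lt (by omega)]
    omega
  rwa [h2, h2] at h1

theorem prod_esymmVar_eq_monomial (a : Fin d) (σ : SetPartition d) :
    ∏ B ∈ σ.parts.erase (σ.part a), esymmVar d #B =
      MvPolynomial.monomial (restExponent a σ) 1 := by
  have h1 : ∏ B ∈ σ.parts.erase (σ.part a), esymmVar d #B =
      (((restType a σ).map fun k => Fin.ofNat d (k - 1)).map MvPolynomial.X).prod := by
    rw [Multiset.map_map, restType, Multiset.map_map]
    refine prod_congr rfl fun B hB => ?_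
    have := restType_bounds (a := a) (σ := σ) (Multiset.mem_map_of_mem Finset.card hB)
    obtain ⟨k, hk⟩ := Nat.exists_eq_succ_of_ne_zero this.1.ne'
    simp only [Function.comp_apply, hk, Nat.succ_eq_add_one, Nat.add_sub_cancel, esymmVar]
    rw [dif_pos (by omega)]
    congr 1
    ext
    rw [Fin.val_ofNat, Nat.mod_eq_of_lt (by omega)]
  rw [h1, restExponent]
  generalize (restType a σ).map (fun k => Fin.ofNat d (k - 1)) = s
  induction s using Multiset.induction_on with
  | empty => simp
  | cons x s ih =>
    rw [Multiset.map_cons, Multiset.prod_cons, ih, ← Multiset.singleton_add, map_add,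
      Multiset.toFinsupp_singleton, MvPolynomial.X, MvPolynomial.monomial_mul, one_mul]

/-- If the sum over the proper colourings of `G` with given colour of the vertex `a` is a
nonnegative combination of elementary symmetric polynomials, then `G` is `(e)`-positive modulo
`a`. -/
theorem isEPositiveMod_of_sum_proper_eq {G : SimpleGraph (Fin d)} {a : Fin d}
    {r : ℕ → MvPolynomial (Fin d) ℚ} (hr : ∀ b, r b ∈ nonnegCoeffs (Fin d))
    (h : ∀ i : Fin d, ∀ c : SetPartition d → ℚ, Y G = ∑ σ, c σ • elementary σ →
      ∑ σ : SetPartition d, c σ • ((∏ B ∈ σ.parts.erase (σ.part a),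
      ((#B).factorial * MvPolynomial.esymm (Fin d) ℚ #B)) *
        (((blockSize σ a - 1).factorial : MvPolynomial (Fin d) ℚ) *
          markedEsymm i (blockSize σ a))) =
      ∑ b ∈ range d, substEsymm d (r b) * markedEsymm i (b + 1)) :
    IsEPositiveMod G a := by
  obtain ⟨c, hc⟩ := exists_Y_eq_sum_elementary G
  refine ⟨c, hc, fun π => ?_⟩
  have hpos : ∀ σ : SetPartition d, 0 < blockSize σ a := fun σ =>
    card_pos.2 ⟨a, σ.mem_part_self.2 (mem_univ a)⟩
  have hle : ∀ σ : SetPartition d, blockSize σ a ≤ d := fun σ => by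
    simpa [blockSize] using card_le_univ (σ.part a)
  -- `l b` is the formal coefficient of `markedEsymm i (b + 1)` in the image of the expansion; it
  -- does not depend on `i`, so independence identifies it with `r b`.
  let l : ℕ → MvPolynomial (Fin d) ℚ := fun b => ∑ σ : SetPartition d with blockSize σ a - 1 = b,
    MvPolynomial.monomial (restExponent a σ) (c σ * arrangements a σ)
  have hl : ∀ i : Fin d, ∑ b ∈ range d, substEsymm d (l b) * markedEsymm i (b + 1) =
      ∑ b ∈ range d, substEsymm d (r b) * markedEsymm i (b + 1) := by
    intro i
    rw [← h i c hc, ← sum_fiberwise_of_maps_to (s := univ) (t := range d)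
      (g := fun σ : SetPartition d => blockSize σ a - 1)]
    · refine sum_congr rfl fun b _ => ?_
      simp only [l]
      rw [map_sum, sum_mul]
      refine sum_congr rfl fun σ hσ => ?_
      have hb : b + 1 = blockSize σ a := by
        have := (mem_filter.1 hσ).2
        have := hpos σ
        omega
      have h1 : (MvPolynomial.monomial (restExponent a σ) (c σ * arrangements a σ) :
          MvPolynomial (Fin d) ℚ) = c σ • ((∏ B ∈ σ.parts.erase (σ.part a),
            ((#B).factorial * esymmVar d #B)) *
              ((blockSize σ a - 1).factorial : MvPolynomial (Fin d) ℚ)) := by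
        have h2 : ∏ B ∈ σ.parts.erase (σ.part a), ((#B).factorial : MvPolynomial (Fin d) ℚ) =
            (((restType a σ).map Nat.factorial).prod : ℕ) := by
          rw [restType, Multiset.map_map, ← Nat.cast_prod]
          rfl
        rw [prod_mul_distrib, prod_esymmVar_eq_monomial, h2, mul_right_comm, ← Nat.cast_mul,
          ← arrangements, ← MvPolynomial.C_eq_coe_nat, MvPolynomial.C_mul_monomial,
          MvPolynomial.smul_monomial, mul_one, smul_eq_mul]
      rw [h1, map_smul, map_mul, map_prod, hb, smul_mul_assoc, mul_assoc, map_natCast]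
      simp only [map_mul, map_natCast, substEsymm_esymmVar]
    · intro σ _
      have := hpos σ
      have := hle σ
      exact mem_range.2 (by omega)
  have hlr : ∀ b < d, l b = r b := by
    intro b hb
    have h1 := eq_zero_of_sum_markedEsymm_eq_zero
      (a := fun b => substEsymm d (l b) - substEsymm d (r b)) (fun i => by
        simp only [sub_mul, sum_sub_distrib]
        exact sub_eq_zero.2 (hl i)) b hb
    exact substEsymm_injective (sub_eq_zero.1 h1)
  have hcoeff : 0 ≤ (l (blockSize π a - 1)).coeff (restExponent a π) := by
    rw [hlr _ (by have := hpos π; have := hle π; omega)]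
    exact hr _ _
  -- A congruence class is determined by the marked block size and the sizes of the other blocks,
  -- and `arrangements` is constant on it.
  have hclass : (l (blockSize π a - 1)).coeff (restExponent a π) =
      classCoeff a c π * arrangements a π := by
    simp only [l]
    rw [MvPolynomial.coeff_sum, classCoeff, sum_mul, sum_filter, sum_filter]
    refine sum_congr rfl fun σ _ => ?_
    rw [MvPolynomial.coeff_monomial]
    by_cases hπσ : CongrMod a π σ
    · have h1 := congrMod_iff.1 hπσ
      rw [if_pos hπσ, if_pos (by rw [h1.1]), if_pos (restExponent_inj.2 h1.2.symm),
        arrangements, arrangements, h1.1, h1.2]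
    · rw [if_neg hπσ]
      by_cases h1 : blockSize σ a - 1 = blockSize π a - 1
      · rw [if_pos h1, if_neg]
        intro h2
        refine hπσ (congrMod_iff.2 ⟨?_, (restExponent_inj.1 h2).symm⟩)
        have := hpos σ
        have := hpos π
        omega
      · rw [if_neg h1]
  rw [hclass] at hcoeff
  refine nonneg_of_mul_nonneg_left hcoeff ?_
  have : 0 < arrangements a π := by
    refine Nat.mul_pos (Nat.pos_of_ne_zero fun h0 => ?_) (Nat.factorial_pos _)
    obtain ⟨k, -, hk⟩ := Multiset.mem_map.1 (Multiset.prod_eq_zero_iff.1 h0)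
    exact (Nat.factorial_pos k).ne' hk
  exact_mod_cast this

end Criterion

/-! ### Positivity of the coefficients -/

section Positivity

variable {N : ℕ}

/-- The coefficients of the inverse of `denomSeries`, before substitution. -/
noncomputable def inverseCoeff (N : ℕ) : ℕ → MvPolynomial (Fin N) ℚ
  | 0 => 1
  | n + 1 => ∑ j : Fin (n + 1), (j : MvPolynomial (Fin N) ℚ) * esymmVar N (j + 1) *
      inverseCoeff N (n - j)

theorem inverseCoeff_mem_nonnegCoeffs (n : ℕ) : inverseCoeff N n ∈ nonnegCoeffs (Fin N) := by
  induction n using Nat.strong_induction_on with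
  | _ n ih =>
    cases n with
    | zero =>
      rw [inverseCoeff]
      exact one_mem _
    | succ n =>
      rw [inverseCoeff]
      exact sum_mem fun j _ => mul_mem (mul_mem (natCast_mem _ _) (esymmVar_mem_nonnegCoeffs _))
        (ih _ (by omega))

/-- The z^k coefficient of `denomSeries` is (1 - k) e_k, so the recurrence defining `inverseCoeff`
is the condition that the product be 1. Its multipliers k - 1 for k ≥ 1 are nonnegative. -/
theorem mk_inverseCoeff_mul_denomSeries :
    (PowerSeries.mk fun n => substEsymm N (inverseCoeff N n)) * denomSeries (Fin N) = 1 := by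
  have hD : ∀ k, PowerSeries.coeff k (denomSeries (Fin N)) =
      (1 - k) * MvPolynomial.esymm (Fin N) ℚ k := by
    intro k
    rw [denomSeries, map_sub, coeff_eulerOp, coeff_esymmSeries, esymmOn_univ]
    ring
  rw [mul_comm]
  ext1 n
  rw [PowerSeries.coeff_mul]
  simp only [hD, PowerSeries.coeff_mk]
  cases n with
  | zero => simp [inverseCoeff, MvPolynomial.esymm_zero]
  | succ n =>
    rw [Nat.sum_antidiagonal_eq_sum_range_succ (fun k l => (1 - (k : MvPolynomial (Fin N) ℚ)) *
      MvPolynomial.esymm (Fin N) ℚ k * substEsymm N (inverseCoeff N l)), sum_range_succ',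
      Nat.sub_zero, inverseCoeff, map_sum, Fin.sum_univ_eq_sum_range (fun j => substEsymm N
        ((j : MvPolynomial (Fin N) ℚ) * esymmVar N (j + 1) * inverseCoeff N (n - j))),
      MvPolynomial.esymm_zero, Nat.cast_zero, sub_zero, one_mul, one_mul, ← sum_add_distrib,
      PowerSeries.coeff_one, if_neg n.succ_ne_zero]
    refine sum_eq_zero fun j _ => ?_
    rw [Nat.add_sub_add_right, map_mul, map_mul, map_natCast, substEsymm_esymmVar]
    push_cast
    ring

/-- The coefficient of `markedEsymm i (b + 1)` in the `n`-th coefficient of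
`denomSeries * markedSeries`, before substitution. -/
noncomputable def numerCoeff (N : ℕ) : ℕ → ℕ → MvPolynomial (Fin N) ℚ
  | 0, _ => 0
  | 1, _ => 0
  -- With n = k + 2: n² - 3n + 3 = k² + k + 1, n² - 3n + 2 = k² + k, n - 2 = k and 3n - 3 = 3k + 3.
  | k + 2, b =>
    (if b = 1 then ((k ^ 2 + k + 1 : ℕ) : MvPolynomial (Fin N) ℚ) * esymmVar N (k + 2) else 0) +
    (if b = 0 then ((k ^ 2 + k : ℕ) : MvPolynomial (Fin N) ℚ) * esymmVar N (k + 3) else 0) +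
    (if b = k + 2 then (k : MvPolynomial (Fin N) ℚ) * esymmVar N 1 else 0) +
    (if b = k + 3 then ((3 * k + 3 : ℕ) : MvPolynomial (Fin N) ℚ) else 0)

theorem numerCoeff_mem_nonnegCoeffs (n b : ℕ) : numerCoeff N n b ∈ nonnegCoeffs (Fin N) := by
  match n with
  | 0 => exact zero_mem _
  | 1 => exact zero_mem _
  | k + 2 =>
    rw [numerCoeff]
    refine add_mem (add_mem (add_mem ?_ ?_) ?_) ?_
    · split_ifs
      · exact mul_mem (natCast_mem _ _) (esymmVar_mem_nonnegCoeffs _)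
      · exact zero_mem _
    · split_ifs
      · exact mul_mem (natCast_mem _ _) (esymmVar_mem_nonnegCoeffs _)
      · exact zero_mem _
    · split_ifs
      · exact mul_mem (natCast_mem _ _) (esymmVar_mem_nonnegCoeffs _)
      · exact zero_mem _
    · split_ifs
      · exact natCast_mem _ _
      · exact zero_mem _

theorem coeff_denomSeries_mul_markedSeries_eq_sum (i : Fin N) {n : ℕ} (hn : n + 2 ≤ N) :
    PowerSeries.coeff n (denomSeries (Fin N) * markedSeries i) =
      ∑ b ∈ range N, substEsymm N (numerCoeff N n b) * markedEsymm i (b + 1) := by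
  rw [coeff_denomSeries_mul_markedSeries]
  match n with
  -- For n = 0 and n = 1 the general formula has negative terms, but they cancel: 3 M_{i,2} + 2 e_1
  -- M_{i,1} - 2 e_1 M_{i,1} - 3 M_{i,2} = 0 and e_1 M_{i,2} - e_1 M_{i,2} = 0.
  | 0 =>
    have h1 : markedEsymm i 1 = MvPolynomial.X i := by simp [markedEsymm, esymmOn_zero]
    simp only [numerCoeff, map_zero, zero_mul, sum_const_zero, MvPolynomial.esymm_zero]
    push_cast
    ring
  | 1 =>
    simp only [numerCoeff, map_zero, zero_mul, sum_const_zero]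
    push_cast
    ring
  | k + 2 =>
    simp only [numerCoeff, map_add, add_mul, sum_add_distrib, apply_ite (substEsymm N), map_mul,
      map_natCast, map_zero, ite_mul, zero_mul, sum_ite_eq', substEsymm_esymmVar, mem_range]
    rw [if_pos (by omega), if_pos (by omega), if_pos (by omega), if_pos (by omega)]
    push_cast
    ring

theorem coeff_markedSeries_eq_sum (i : Fin N) {m : ℕ} (hm : m + 2 ≤ N) :
    PowerSeries.coeff m (markedSeries i) =
      ∑ b ∈ range N, substEsymm N (∑ x ∈ antidiagonal m,
        inverseCoeff N x.1 * numerCoeff N x.2 b) * markedEsymm i (b + 1) := by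
  have h : markedSeries i = (PowerSeries.mk fun n => substEsymm N (inverseCoeff N n)) *
      (denomSeries (Fin N) * markedSeries i) := by
    rw [← mul_assoc, mk_inverseCoeff_mul_denomSeries, one_mul]
  rw [h, PowerSeries.coeff_mul]
  simp only [map_sum, sum_mul]
  rw [sum_comm]
  refine sum_congr rfl fun x hx => ?_
  have := mem_antidiagonal.1 hx
  rw [PowerSeries.coeff_mk, coeff_denomSeries_mul_markedSeries_eq_sum i (by omega), mul_sum]
  refine sum_congr rfl fun b _ => ?_
  rw [map_mul, mul_assoc]

end Positivity

end NCChromatic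

theorem mainTheorem3 (m : ℕ) (hm : 3 ≤ m) :
    NCChromatic.IsEPositive (NCChromatic.cycleChordThree m) := by
  obtain ⟨n, rfl⟩ : ∃ n, m = n + 1 := ⟨m - 1, by omega⟩
  -- The witness is the coefficient of z^m in 1/D times the numerator, in formal variables; the
  -- number of colours equals the number m + 2 of vertices.
  refine NCChromatic.isEPositiveMod_of_sum_proper_eq (r := fun b =>
    ∑ x ∈ Finset.HasAntidiagonal.antidiagonal (n + 1), NCChromatic.inverseCoeff (n + 1 + 2) x.1 *
      NCChromatic.numerCoeff (n + 1 + 2) x.2 b) (fun b => ?_) fun i c hc => ?_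
  · exact sum_mem fun x _ => mul_mem (NCChromatic.inverseCoeff_mem_nonnegCoeffs _)
      (NCChromatic.numerCoeff_mem_nonnegCoeffs _ _)
  · rw [← NCChromatic.coeff_markedSeries_eq_sum i le_rfl,
      ← NCChromatic.sum_proper_cycleChordThree (by omega) i,
      ← NCChromatic.sum_proper_prod_X_eq hc]
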